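/- Let $G$ be a real Lie group modelled on a reflexive Banach space (for instance a finite-dimensional one), with Lie algebra $\mathfrak g=T_eG$; put $R_g h=hg$, $Ad_g=T_e(h\mapsto g^{-1}hg)$, let $ad_\xi\eta=[\xi,\eta]$ be the derivative of $g\mapsto Ad_g$ at $e$, and $\langle ad_\xi^*\mu,\eta\rangle=\langle\mu,[\xi,\eta]\rangle$ for $\mu\in\mathfrak g^*$. Let $G\circledS\mathfrak g^*$ be the manifold $G\times\mathfrak g^*$ and ${}^1TT^*G$ the manifold of points $(g,\mu,\xi,\nu)$, $(g,\mu)\in G\times\mathfrak g^*$, $(\xi,\nu)\in\mathfrak g\times\mathfrak g^*$, with projection ${}^1\tau(g,\mu,\xi,\nu)=(g,\mu)$. Let $\theta_1$ be the one-form on ${}^1TT^*G$ whose value at $(g,\mu,\xi,\nu)$ on a tangent vector with first two components $(TR_g\xi_2,\ \nu_2+ad^*_{\xi_2}\mu)$ is $$\langle\nu,\xi_2\rangle-\langle\nu_2,\xi\rangle+\langle\mu,[\xi,\xi_2]\rangle .$$ Let $\theta$ be the canonical one-form on $G\circledS\mathfrak g^*$, whose value at $(g,\mu)$ on $(TR_g\xi,\,m)$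 is $\langle\mu,\xi\rangle$, and let $\Omega_{G\circledS\mathfrak g^*}=d\theta$. Let $\bar H:G\circledS\mathfrak g^*\to\mathbb R$ be smooth, with partial derivatives $\delta\bar H/\delta g\in T_g^*G$ and $\delta\bar H/\delta\mu\in\mathfrak g^{**}=\mathfrak g$, and write $T^*R_g\,\alpha=\alpha\circ T_eR_g$ for $\alpha\in T_g^*G$. Then: 1. $d\theta_1$ is nondegenerate, i.e. an exact (weakly) symplectic form on ${}^1TT^*G$, and the set $S'$ of all points of ${}^1TT^*G$ at which $-({}^1\tau)^*d\bar H=\theta_1$ is a Lagrangian submanifold of $({}^1TT^*G,d\theta_1)$: an embedded smooth submanifold whose tangent space at each point is its own $d\theta_1$-orthogonal. 2. $$S'=\Big\{\Big(g,\mu,\frac{\delta\bar H}{\delta\mu},-T^*R_g\frac{\delta\bar H}{\delta g}\Big):(g,\mu)\in G\circledS\mathfrak g^*\Big\}.$$ 3. There is exactly one vector field $X_{\bar H}$ on $G\circledS\mathfrak g^*$ with $i_{X_{\bar H}}\Omega_{G\circledS\mathfrak g^*}=-d\bar H$, namely $$X_{\bar H}(g,\mu)=\Big(T_eR_g\frac{\delta\bar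 H}{\delta\mu},\ ad^*_{\delta\bar H/\delta\mu}\mu-T^*R_g\frac{\delta\bar H}{\delta g}\Big),$$ and the reconstruction mapping ${}^1TT^*G\to T(G\circledS\mathfrak g^*)$, $(g,\mu,\xi,\nu)\mapsto(g,\mu;\,TR_g\xi,\ \nu+ad_\xi^*\mu)$, maps $S'$ onto the image of $X_{\bar H}$. 4. If a curve $(g(t),\mu(t))$ in $G\circledS\mathfrak g^*$ is differentiable at a time $t$, then its velocity at $t$ lies in the reconstruction of $S'$ if and only if the trivialized Hamilton equations $$\frac{dg}{dt}=T_eR_g\frac{\delta\bar H}{\delta\mu},\qquad \frac{d\mu}{dt}=ad^*_{\delta\bar H/\delta\mu}\mu-T^*R_g\frac{\delta\bar H}{\delta g}$$ hold at $t$. -/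

import Mathlib

open scoped Manifold ContDiff

noncomputable section

/-! ### One-forms, exterior derivative, Lagrangian submanifolds -/

section Forms

variable {E H M : Type*} [NormedAddCommGroup E] [NormedSpace ℝ E] [TopologicalSpace H]
  (I : ModelWithCorners ℝ E H) [TopologicalSpace M] [ChartedSpace H M]

/-- A (not necessarily smooth) one-form on `M`. -/
abbrev OneForm := ∀ p : M, TangentSpace I p →L[ℝ] ℝ

/-- The expression of the one-form `θ` in the preferred chart at `p`, that is, the pullback of `θ`
by the inverse chart, a one-form on (a part of) the model vector space. -/
def OneForm.inChart (θ : OneForm I (M := M)) (p : M) (y : E) : E →L[ℝ] ℝ :=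
  (θ ((extChartAt I p).symm y)).comp
    (mfderivWithin 𝓘(ℝ, E) I (extChartAt I p).symm (Set.range I) y)

/-- The exterior derivative `dθ` of a one-form `θ`, a two-form: at `p` it is Mathlib's exterior
derivative of the expression of `θ` in the chart at `p`, evaluated on the coordinate expressions of
the two tangent vectors. -/
def OneForm.d (θ : OneForm I (M := M)) (p : M) (v w : TangentSpace I p) : ℝ :=
  extDerivWithin
    (fun y => ContinuousAlternatingMap.ofSubsingleton ℝ E ℝ (0 : Fin 1) (OneForm.inChart I θ p y))
    (Set.range I) (extChartAt I p p)
    ![mfderiv I 𝓘(ℝ, E) (extChartAt I p) p v, mfderiv I 𝓘(ℝ, E) (extChartAt I p) p w]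

/-- The differential `df` of a real function, as a one-form. -/
def dOneForm (f : M → ℝ) : OneForm I (M := M) :=
  fun p => (mfderiv I 𝓘(ℝ, ℝ) f p : TangentSpace I p →L[ℝ] ℝ)

/-- The one-form `θ` is a symplectic potential: its exterior derivative is nondegenerate, so that
`dθ` is an exact symplectic two-form. -/
def IsSymplecticPotential (θ : OneForm I (M := M)) : Prop :=
  ∀ (p : M) (v : TangentSpace I p), (∀ w : TangentSpace I p, OneForm.d I θ p v w = 0) → v = 0

/-- `S` is an embedded smooth submanifold near `p`, and the smooth chart `φ` of `M` around `p`
flattens it to the (affine translate through `φ p` of the) complemented closed subspace `F`. -/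
structure IsSliceChart (S : Set M) (p : M) (φ : OpenPartialHomeomorph M H) (F : Submodule ℝ E) :
    Prop where
  mem_atlas : φ ∈ IsManifold.maximalAtlas I ∞ M
  mem_source : p ∈ φ.source
  complemented : F.ClosedComplemented
  mem_iff : ∀ q ∈ φ.source, q ∈ S ↔ φ.extend I q - φ.extend I p ∈ F

/-- The tangent space `T_p S`, read off from a slice chart. -/
def sliceTangent (p : M) (φ : OpenPartialHomeomorph M H) (F : Submodule ℝ E) :
    Set (TangentSpace I p) :=
  {v | (mfderiv I 𝓘(ℝ, E) (φ.extend I) p v : E) ∈ F}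

/-- `S` is a Lagrangian submanifold of `M` for the two-form `Ω`: it is an embedded smooth
submanifold, and at each of its points the tangent space `T_p S` is equal to its own
`Ω`-orthogonal. -/
def IsLagrangianSubmanifold (Ω : ∀ p : M, TangentSpace I p → TangentSpace I p → ℝ)
    (S : Set M) : Prop :=
  ∀ p ∈ S, ∃ (φ : OpenPartialHomeomorph M H) (F : Submodule ℝ E), IsSliceChart I S p φ F ∧
    ∀ v : TangentSpace I p,
      v ∈ sliceTangent I p φ F ↔ ∀ w ∈ sliceTangent I p φ F, Ω p v w = 0

end Forms

/-- The pullback `f^* θ` of a one-form. -/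
def OneForm.pullback {E H M E' H' M' : Type*}
    [NormedAddCommGroup E] [NormedSpace ℝ E] [TopologicalSpace H] (I : ModelWithCorners ℝ E H)
    [TopologicalSpace M] [ChartedSpace H M]
    [NormedAddCommGroup E'] [NormedSpace ℝ E'] [TopologicalSpace H'] (I' : ModelWithCorners ℝ E' H')
    [TopologicalSpace M'] [ChartedSpace H' M']
    (f : M → M') (θ : OneForm I' (M := M')) : OneForm I (M := M) :=
  fun p => (θ (f p)).comp (mfderiv I I' f p)

/-- Reflexivity of a normed space: the canonical map into the bidual is onto. -/
class IsReflexiveSpace (E : Type*) [NormedAddCommGroup E] [NormedSpace ℝ E] : Prop where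
  surjective : Function.Surjective (NormedSpace.inclusionInDoubleDual ℝ E)

/-! ### Right trivialization on a Lie group

`G` is a Lie group modelled on `E`. The Lie algebra `𝔤 = T_e G` is, in Mathlib, the type `E`, and
`𝔤^* = StrongDual ℝ E`. -/

section LieGroup

variable {E : Type*} [NormedAddCommGroup E] [NormedSpace ℝ E]
  {G : Type*} [TopologicalSpace G] [ChartedSpace E G] [Group G]

/-- `T_e R_g : 𝔤 → T_g G`. -/
def tangentR (g : G) : E →L[ℝ] TangentSpace 𝓘(ℝ, E) g :=
  mfderiv 𝓘(ℝ, E) 𝓘(ℝ, E) (fun h : G => h * g) 1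

/-- `T_g R_{g⁻¹} : T_g G → 𝔤`. -/
def tangentRInv (g : G) : TangentSpace 𝓘(ℝ, E) g →L[ℝ] E :=
  mfderiv 𝓘(ℝ, E) 𝓘(ℝ, E) (fun h : G => h * g⁻¹) g

variable (E) in
/-- The right adjoint action `Ad_g = T_e I_g`, where `I_g h = g⁻¹ h g`. -/
def rightAd (g : G) : E →L[ℝ] E :=
  mfderiv 𝓘(ℝ, E) 𝓘(ℝ, E) (fun h : G => g⁻¹ * h * g) 1

variable (E G) in
/-- The infinitesimal right adjoint representation `ad_ξ η = [ξ, η]`, the derivative of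
`g ↦ Ad_g` at the identity. -/
def ad : E →L[ℝ] E →L[ℝ] E :=
  mfderiv 𝓘(ℝ, E) 𝓘(ℝ, E →L[ℝ] E) (fun g : G => rightAd E g) 1

variable (G) in
/-- `ξ ↦ ad^*_ξ μ`, where `⟨ad^*_ξ μ, η⟩ = ⟨μ, [ξ, η]⟩`. -/
def coad (μ : StrongDual ℝ E) : E →L[ℝ] StrongDual ℝ E :=
  (ContinuousLinearMap.compL ℝ E E ℝ μ).comp (ad E G)

theorem coad_apply (μ : StrongDual ℝ E) (ξ η : E) : coad G μ ξ η = μ (ad E G ξ η) := rfl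

variable (E) in
/-- The model with corners of the manifold `G ⓢ 𝔤^*`. -/
abbrev modelB : ModelWithCorners ℝ (E × StrongDual ℝ E) (ModelProd E (StrongDual ℝ E)) :=
  𝓘(ℝ, E).prod 𝓘(ℝ, StrongDual ℝ E)

variable (E) in
/-- The model with corners of the manifold `¹TT^*G = (G ⓢ 𝔤^*) ⓢ (𝔤 ⓢ 𝔤^*)`. -/
abbrev modelTT : ModelWithCorners ℝ ((E × StrongDual ℝ E) × (E × StrongDual ℝ E))
    (ModelProd (ModelProd E (StrongDual ℝ E)) (E × StrongDual ℝ E)) :=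
  (modelB E).prod 𝓘(ℝ, E × StrongDual ℝ E)

variable (E G) in
/-- The manifold `G ⓢ 𝔤^*`, with points `(g, μ)`. -/
abbrev TrivB := G × StrongDual ℝ E

variable (E G) in
/-- The manifold `¹TT^*G`, with points `((g, μ), (ξ, ν))`. -/
abbrev TrivTT := TrivB E G × (E × StrongDual ℝ E)

/-- The right trivialization of `T(G ⓢ 𝔤^*)` at `(g, μ)`:
`(V, m) ↦ (T R_{g⁻¹} V, m - ad^*_{T R_{g⁻¹} V} μ)`. -/
def trivB (q : TrivB E G) : TangentSpace (modelB E) q →L[ℝ] E × StrongDual ℝ E :=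
  let ξ : E × StrongDual ℝ E →L[ℝ] E :=
    (tangentRInv q.1).comp (ContinuousLinearMap.fst ℝ E (StrongDual ℝ E))
  (ξ.prod (ContinuousLinearMap.snd ℝ E (StrongDual ℝ E) - (coad G q.2).comp ξ) :
    E × StrongDual ℝ E →L[ℝ] E × StrongDual ℝ E)

/-- The reconstruction mapping `¹TT^*G → T(G ⓢ 𝔤^*)`:
`(g, μ, ξ, ν) ↦ (g, μ; T R_g ξ, ν + ad^*_ξ μ)`. -/
def reconstruct (p : TrivTT E G) : TangentBundle (modelB E) (TrivB E G) :=
  ⟨p.1, ((tangentR p.1.1 p.2.1, p.2.2 + coad G p.1.2 p.2.1) : E × StrongDual ℝ E)⟩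

/-- The canonical one-form on `G ⓢ 𝔤^*`, with value `⟨μ, ξ⟩` on the vector with right
trivialization `(ξ, ν)`. -/
def thetaB : OneForm (modelB E) (M := TrivB E G) :=
  fun q => (q.2.comp (ContinuousLinearMap.fst ℝ E (StrongDual ℝ E))).comp (trivB q)

/-- The projection `¹τ : ¹TT^*G → G ⓢ 𝔤^*`. -/
def tau (p : TrivTT E G) : TrivB E G := p.1

/-- The one-form `θ₁` on `¹TT^*G`. If the first two components of a tangent vector at
`(g, μ, ξ, ν)` are `(T R_g ξ₂, ν₂ + ad^*_{ξ₂} μ)`, as for the right invariant vector field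
generated by `(ξ₂, ν₂, ξ₃, ν₃)`, its value is `⟨ν, ξ₂⟩ - ⟨ν₂, ξ⟩ + ⟨μ, [ξ, ξ₂]⟩`. -/
def theta1 : OneForm (modelTT E) (M := TrivTT E G) :=
  fun p =>
    ((p.2.2 + p.1.2.comp (ad E G p.2.1)).comp (ContinuousLinearMap.fst ℝ E (StrongDual ℝ E))
      - (NormedSpace.inclusionInDoubleDual ℝ E p.2.1).comp
          (ContinuousLinearMap.snd ℝ E (StrongDual ℝ E))).comp
      ((trivB p.1).comp
        (ContinuousLinearMap.fst ℝ (E × StrongDual ℝ E) (E × StrongDual ℝ E)))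

theorem theta1_apply (g : G) (μ : StrongDual ℝ E) (ξ : E) (ν : StrongDual ℝ E)
    (V : E) (m : StrongDual ℝ E) (x : E × StrongDual ℝ E) :
    theta1 (((g, μ), (ξ, ν)) : TrivTT E G) ((V, m), x) =
      ν (tangentRInv g V) - (m - coad G μ (tangentRInv g V)) ξ
        + μ (ad E G ξ (tangentRInv g V)) := by
  change ν (tangentRInv g V) + μ (ad E G ξ (tangentRInv g V))
    - (m - coad G μ (tangentRInv g V)) ξ = _
  ring

/-- `δH/δg ∈ T_g^* G`. -/
def deltaG (H : TrivB E G → ℝ) (q : TrivB E G) : TangentSpace 𝓘(ℝ, E) q.1 →L[ℝ] ℝ :=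
  dOneForm 𝓘(ℝ, E) (fun h : G => H (h, q.2)) q.1

/-- `δH/δμ ∈ 𝔤`: the derivative of `H` in the direction of `𝔤^*` is an element of the bidual of
`𝔤`, hence is given by an element of `𝔤`. -/
def deltaMu [IsReflexiveSpace E] (H : TrivB E G → ℝ) (q : TrivB E G) : E :=
  Function.surjInv (IsReflexiveSpace.surjective (E := E))
    (fderiv ℝ (fun μ : StrongDual ℝ E => H (q.1, μ)) q.2)

/-- `T_e^* R_g (δH/δg) ∈ 𝔤^*`. -/
def pulledDeltaG (H : TrivB E G → ℝ) (q : TrivB E G) : StrongDual ℝ E :=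
  (deltaG H q).comp (tangentR q.1)

/-- The subset of `¹TT^*G` defined by the equation `-(¹τ)^* dH = θ₁`. -/
def hamiltonianSet (H : TrivB E G → ℝ) : Set (TrivTT E G) :=
  {p | -(OneForm.pullback (modelTT E) (modelB E) tau (dOneForm (modelB E) H) p) = theta1 p}

/-- `X` is a Hamiltonian vector field of `H` on `G ⓢ 𝔤^*`: `i_X Ω = -dH`, where `Ω` is the
exterior derivative of the canonical one-form. -/
def IsHamiltonianVectorField (H : TrivB E G → ℝ)
    (X : ∀ q : TrivB E G, TangentSpace (modelB E) q) : Prop :=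
  ∀ (q : TrivB E G) (w : TangentSpace (modelB E) q),
    OneForm.d (modelB E) thetaB q (X q) w = -(dOneForm (modelB E) H q w)

/-- The velocity of a curve in `G ⓢ 𝔤^*` at time `t`, an element of `T(G ⓢ 𝔤^*)`. -/
def velocity (γ : ℝ → TrivB E G) (t : ℝ) : TangentBundle (modelB E) (TrivB E G) :=
  ⟨γ t, mfderiv 𝓘(ℝ, ℝ) (modelB E) γ t (1 : ℝ)⟩

/-- The trivialized Hamilton equations for the curve `γ = (g, μ)` at time `t`:
`dg/dt = T_e R_g (δH/δμ)` and `dμ/dt = ad^*_{δH/δμ} μ - T_e^* R_g (δH/δg)`. -/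
def SolvesHamiltonAt [IsReflexiveSpace E] (H : TrivB E G → ℝ) (γ : ℝ → TrivB E G) (t : ℝ) :
    Prop :=
  (mfderiv 𝓘(ℝ, ℝ) 𝓘(ℝ, E) (fun s => (γ s).1) t (1 : ℝ) : TangentSpace 𝓘(ℝ, E) (γ t).1)
      = tangentR (γ t).1 (deltaMu H (γ t)) ∧
    deriv (fun s => (γ s).2) t
      = coad G (γ t).2 (deltaMu H (γ t)) - pulledDeltaG H (γ t)

end LieGroup

end

/-! Everything rests on explicit formulas for `dθ` and `dθ₁`. In the chart at `g`, the canonical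
form is `μ ∘ ρ`, where `ρ` is the right Maurer-Cartan form (`mcForm`). Antisymmetrizing its
derivative produces the exchange terms between `𝔤` and `𝔤^*`, and the Maurer-Cartan equation
`fderiv_mcForm_sub` turns the derivative of `ρ` into a bracket (`d_thetaB`). In `θ₁` the two terms
containing `μ` cancel because the bracket is antisymmetric, leaving `⟨ν, ρ(V)⟩ - ⟨m, ξ⟩` on a vector
starting with `(V, m)`; `d_theta1` follows in the same way. Nondegeneracy is then read off by
testing against one component at a time.

The Maurer-Cartan equation itself is a statement about second derivatives of the multiplication in a
chart at the identity. Both the derivative of conjugation, which defines `ad`, and the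
antisymmetrized derivative of `ρ` reduce to the antisymmetrized mixed second derivative
`germBracket`.

Evaluating `-dH = θ₁` on vectors `(0, m)` and `(T R_g ζ, 0)` determines `ξ` and `ν`, so the solution
set is the graph of a section `σ` (`mem_hamiltonianSet_iff`). Reflexivity places `δH/δμ` in `𝔤`, and
`σ` is smooth. In coordinates `σ` pulls `θ₁` back to `-dH`, which is closed, so the graph is
isotropic (`d_theta1_hamiltonianSection`). It is maximal because a vertical vector orthogonal to all
graph vectors vanishes (`mem_range_of_d_theta1_eq_zero`). Shearing by `σ` supplies the slice charts.
For the dynamics, the reconstruction of `σ` is exactly the vector that solves `i_X Ω = -dH`. -/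

open Filter Topology

/-! ### Second-order calculus of a group law in a chart at the identity -/

section GroupGerm

variable {E F : Type*} [NormedAddCommGroup E] [NormedSpace ℝ E]
  [NormedAddCommGroup F] [NormedSpace ℝ F]

theorem fderiv_comp_prodMk_left {f : E × E → F} {x y : E} (hf : DifferentiableAt ℝ f (x, y)) :
    HasFDerivAt (fun z => f (z, y)) ((fderiv ℝ f (x, y)).comp (.inl ℝ E E)) x :=
  hf.hasFDerivAt.comp x (hasFDerivAt_prodMk_left x y)

theorem fderiv_comp_prodMk_right {f : E × E → F} {x y : E} (hf : DifferentiableAt ℝ f (x, y)) :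
    HasFDerivAt (fun z => f (x, z)) ((fderiv ℝ f (x, y)).comp (.inr ℝ E E)) y :=
  hf.hasFDerivAt.comp y (hasFDerivAt_prodMk_right x y)

/-- `m` and `i` are the expressions of multiplication and inversion of a Lie group in a chart
around the identity, with `o` the image of the identity. -/
structure IsGroupGerm (m : E × E → E) (i : E → E) (o : E) : Prop where
  contDiffAt_mul : ContDiffAt ℝ 2 m (o, o)
  contDiffAt_inv : ContDiffAt ℝ 2 i o
  inv_one : i o = o
  mul_one : ∀ᶠ x in 𝓝 o, m (x, o) = x
  one_mul : ∀ᶠ x in 𝓝 o, m (o, x) = x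
  inv_mul : ∀ᶠ x in 𝓝 o, m (i x, x) = o

/-- The bracket determined by the second derivative of the multiplication. -/
noncomputable def germBracket (m : E × E → E) (o ξ η : E) : E :=
  fderiv ℝ (fderiv ℝ m) (o, o) (0, ξ) (η, 0) - fderiv ℝ (fderiv ℝ m) (o, o) (0, η) (ξ, 0)

theorem germBracket_swap (m : E × E → E) (o ξ η : E) :
    germBracket m o ξ η = -germBracket m o η ξ := by simp [germBracket]

theorem ContDiffAt.hasFDerivAt_fderiv {f : E → F} {x : E} (hf : ContDiffAt ℝ 2 f x) :
    HasFDerivAt (fderiv ℝ f) (fderiv ℝ (fderiv ℝ f) x) x :=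
  ((hf.fderiv_right (m := 1) (by norm_num)).differentiableAt (by norm_num)).hasFDerivAt

theorem ContDiffAt.eventually_differentiableAt {f : E → F} {x : E} (hf : ContDiffAt ℝ 2 f x) :
    ∀ᶠ y in 𝓝 x, DifferentiableAt ℝ f y :=
  (hf.eventually (by simp)).mono fun _ h => h.differentiableAt (by norm_num)

theorem ContDiffAt.fderiv_fderiv_swap {f : E → F} {x : E} (hf : ContDiffAt ℝ 2 f x) (v w : E) :
    fderiv ℝ (fderiv ℝ f) x v w = fderiv ℝ (fderiv ℝ f) x w v :=
  hf.isSymmSndFDerivAt (by simp) v w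

namespace IsGroupGerm

variable {m : E × E → E} {i : E → E} {o : E} (h : IsGroupGerm m i o)
include h

theorem differentiableAt_mul : DifferentiableAt ℝ m (o, o) :=
  h.contDiffAt_mul.differentiableAt (by norm_num)

theorem fderiv_mul_inl (v : E) : fderiv ℝ m (o, o) (v, 0) = v := by
  have h1 := fderiv_comp_prodMk_left h.differentiableAt_mul
  have h2 : HasFDerivAt (fun z => m (z, o)) (.id ℝ E) o :=
    (hasFDerivAt_id o).congr_of_eventuallyEq h.mul_one
  simpa using DFunLike.congr_fun (h1.unique h2) v

theorem fderiv_mul_inr (v : E) : fderiv ℝ m (o, o) (0, v) = v := by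
  have h1 := fderiv_comp_prodMk_right h.differentiableAt_mul
  have h2 : HasFDerivAt (fun z => m (o, z)) (.id ℝ E) o :=
    (hasFDerivAt_id o).congr_of_eventuallyEq h.one_mul
  simpa using DFunLike.congr_fun (h1.unique h2) v

theorem hasFDerivAt_inv : HasFDerivAt i (-.id ℝ E) o := by
  have hi := (h.contDiffAt_inv.differentiableAt (by norm_num)).hasFDerivAt
  have hm := h.differentiableAt_mul.hasFDerivAt
  rw [← h.inv_one] at hm
  have h1 : HasFDerivAt (fun x => m (i x, x)) _ o :=
    HasFDerivAt.comp (f := fun x => (i x, x)) o (by simpa [h.inv_one] using hm)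
      (hi.prodMk (hasFDerivAt_id o))
  have h2 : HasFDerivAt (fun x => m (i x, x)) (0 : E →L[ℝ] E) o :=
    (hasFDerivAt_const o o).congr_of_eventuallyEq h.inv_mul
  have h3 : fderiv ℝ i o = -.id ℝ E := by
    ext v
    have := DFunLike.congr_fun (h1.unique h2) v
    have e : ((fderiv ℝ i o v, v) : E × E) = (fderiv ℝ i o v, 0) + (0, v) := by simp
    simp only [ContinuousLinearMap.comp_apply, ContinuousLinearMap.prod_apply,
      ContinuousLinearMap.id_apply, zero_apply] at this
    rw [e, map_add, h.fderiv_mul_inl, h.fderiv_mul_inr] at this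
    simpa using eq_neg_of_add_eq_zero_left this
  rwa [h3] at hi

/-- Near `o` the map `s ↦ m (o, s)` is the identity, so its first derivative is locally constant. -/
theorem fderiv_fderiv_inr_inr (v w : E) : fderiv ℝ (fderiv ℝ m) (o, o) (0, v) (0, w) = 0 := by
  have hd : HasFDerivAt (fun s => (fderiv ℝ m (o, s)).comp (.inr ℝ E E))
      ((ContinuousLinearMap.precomp E (.inr ℝ E E)).comp
        ((fderiv ℝ (fderiv ℝ m) (o, o)).comp (.inr ℝ E E))) o :=
    (ContinuousLinearMap.precomp E (ContinuousLinearMap.inr ℝ E E)).hasFDerivAt.comp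
      (f := fun s => fderiv ℝ m (o, s)) o
      (h.contDiffAt_mul.hasFDerivAt_fderiv.comp o (hasFDerivAt_prodMk_right o o))
  have he : (fun s => (fderiv ℝ m (o, s)).comp (.inr ℝ E E)) =ᶠ[𝓝 o] fun _ => .id ℝ E := by
    have hm := (Continuous.prodMk_right o).tendsto o |>.eventually
      h.contDiffAt_mul.eventually_differentiableAt
    filter_upwards [hm, h.one_mul.eventually_nhds] with s hs h1
    exact (fderiv_comp_prodMk_right hs).unique ((hasFDerivAt_id s).congr_of_eventuallyEq h1)
  have := DFunLike.congr_fun (hd.unique ((hasFDerivAt_const _ o).congr_of_eventuallyEq he)) v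
  simpa using DFunLike.congr_fun this w

/-- By the chain rule the linear map at `s` is `D₂m(i s, s) ∘ D₁m(o, s)`. Differentiating at `o`,
where both factors are the identity and `i` has derivative `-id`, leaves two mixed second
derivatives, since the `(0, ξ), (0, η)` term vanishes. Symmetry of the second derivative puts them
in the form of the bracket. -/
theorem hasFDerivAt_conj : HasFDerivAt (fun s => fderiv ℝ (fun x => m (i s, m (x, s))) o)
    (fderiv ℝ (fun s => fderiv ℝ (fun x => m (i s, m (x, s))) o) o) o ∧
    ∀ ξ η, fderiv ℝ (fun s => fderiv ℝ (fun x => m (i s, m (x, s))) o) o ξ η =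
      germBracket m o ξ η := by
  have hc : ContinuousAt (fun s => (i s, s)) o :=
    h.contDiffAt_inv.continuousAt.prodMk continuousAt_id
  have hD := h.contDiffAt_mul.hasFDerivAt_fderiv
  have hev : (fun s => fderiv ℝ (fun x => m (i s, m (x, s))) o) =ᶠ[𝓝 o]
      fun s => (ContinuousLinearMap.precomp E (.inr ℝ E E) (fderiv ℝ m (i s, s))).comp
        (ContinuousLinearMap.precomp E (.inl ℝ E E) (fderiv ℝ m (o, s))) := by
    have h1 : ∀ᶠ s in 𝓝 o, DifferentiableAt ℝ m (i s, s) :=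
      hc.tendsto.eventually (by simpa [h.inv_one] using
        h.contDiffAt_mul.eventually_differentiableAt)
    have h2 := (Continuous.prodMk_right o).tendsto o |>.eventually
      h.contDiffAt_mul.eventually_differentiableAt
    filter_upwards [h1, h2, h.one_mul] with s hs1 hs2 hs
    have := fderiv_comp_prodMk_right hs1
    exact (HasFDerivAt.comp (f := fun x => m (x, s)) o (by rwa [hs])
      (fderiv_comp_prodMk_left hs2)).fderiv
  have hD1 : HasFDerivAt (fun s => fderiv ℝ m (i s, s)) _ o :=
    HasFDerivAt.comp (f := fun x => (i x, x)) o (by simpa [h.inv_one] using hD)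
      (h.hasFDerivAt_inv.prodMk (hasFDerivAt_id o))
  have hD2 : HasFDerivAt (fun s => fderiv ℝ m (o, s)) _ o :=
    hD.comp o (hasFDerivAt_prodMk_right o o)
  have hfin := (((ContinuousLinearMap.precomp E (.inr ℝ E E)).hasFDerivAt.comp o hD1).clm_comp
    ((ContinuousLinearMap.precomp E (.inl ℝ E E)).hasFDerivAt.comp o hD2)).congr_of_eventuallyEq hev
  refine ⟨hfin.differentiableAt.hasFDerivAt, fun ξ η => ?_⟩
  rw [hfin.fderiv]
  have e : ((-ξ, ξ) : E × E) = (0, ξ) - (ξ, 0) := by simp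
  simp only [add_apply, ContinuousLinearMap.comp_apply,
    ContinuousLinearMap.compL_apply, ContinuousLinearMap.flip_apply,
    ContinuousLinearMap.precomp_apply, ContinuousLinearMap.inr_apply,
    ContinuousLinearMap.inl_apply, ContinuousLinearMap.prod_apply, neg_apply,
    ContinuousLinearMap.id_apply, h.inv_one, h.fderiv_mul_inl, h.fderiv_mul_inr, e, map_sub,
    sub_apply, h.fderiv_fderiv_inr_inr, germBracket]
  rw [h.contDiffAt_mul.fderiv_fderiv_swap (ξ, 0)]
  abel

/-- The form is `D₁m(r y, i (r y)) ∘ Dr(y)`. In its derivative the contributions of `D²r` and of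
`D²m` in the first variable alone are symmetric, so only the mixed part of `D²m` survives
antisymmetrization; the minus sign is that of the derivative of `i`. -/
theorem maurerCartan {r : E → E} {y : E} (hr : ContDiffAt ℝ 2 r y) (hy : r y = o) :
    DifferentiableAt ℝ (fun y => fderiv ℝ (fun z => m (r z, i (r y))) y) y ∧
    ∀ v w, fderiv ℝ (fun y => fderiv ℝ (fun z => m (r z, i (r y))) y) y v w
      - fderiv ℝ (fun y => fderiv ℝ (fun z => m (r z, i (r y))) y) y w v
      = -germBracket m o (fderiv ℝ r y v) (fderiv ℝ r y w) := by
  subst hy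
  have hD := h.contDiffAt_mul.hasFDerivAt_fderiv
  have hr' := (hr.differentiableAt (by norm_num)).hasFDerivAt
  have hir : HasFDerivAt (fun y => (r y, i (r y))) _ y :=
    hr'.prodMk (h.hasFDerivAt_inv.comp y hr')
  have hev : (fun y => fderiv ℝ (fun z => m (r z, i (r y))) y) =ᶠ[𝓝 y]
      fun y => (ContinuousLinearMap.precomp E (.inl ℝ E E) (fderiv ℝ m (r y, i (r y)))).comp
        (fderiv ℝ r y) := by
    have h1 : ∀ᶠ y in 𝓝 y, DifferentiableAt ℝ m (r y, i (r y)) :=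
      hir.continuousAt.tendsto.eventually (by simpa [h.inv_one] using
        h.contDiffAt_mul.eventually_differentiableAt)
    filter_upwards [h1, hr.eventually_differentiableAt] with z hz hrz
    exact (HasFDerivAt.comp z (fderiv_comp_prodMk_left hz) hrz.hasFDerivAt).fderiv
  have hD1 : HasFDerivAt (fun y => fderiv ℝ m (r y, i (r y))) _ y :=
    HasFDerivAt.comp (f := fun y => (r y, i (r y))) y (by simpa [h.inv_one] using hD) hir
  have hfin := (((ContinuousLinearMap.precomp E (.inl ℝ E E)).hasFDerivAt.comp y hD1).clm_comp
    hr.hasFDerivAt_fderiv).congr_of_eventuallyEq hev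
  refine ⟨hfin.differentiableAt, fun v w => ?_⟩
  rw [hfin.fderiv]
  have e (ξ : E) : ((ξ, -ξ) : E × E) = (ξ, 0) - (0, ξ) := by simp
  simp only [add_apply, ContinuousLinearMap.comp_apply,
    ContinuousLinearMap.compL_apply, ContinuousLinearMap.flip_apply,
    ContinuousLinearMap.precomp_apply,
    ContinuousLinearMap.inl_apply, ContinuousLinearMap.prod_apply, neg_apply,
    ContinuousLinearMap.id_apply, h.inv_one, h.fderiv_mul_inl, e, map_sub,
    sub_apply, germBracket]
  rw [hr.fderiv_fderiv_swap v w, h.contDiffAt_mul.fderiv_fderiv_swap (_, 0) (_, 0)]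
  abel

end IsGroupGerm
end GroupGerm

/-! ### Manifold derivatives as linear maps between model spaces -/

section ChainRule

theorem two_le_infty : (2 : ℕ∞ω) ≤ ∞ := by
  exact WithTop.coe_le_coe.2 (le_top : (2 : ℕ∞) ≤ ⊤)

variable {E H M E' H' M' E'' H'' M'' : Type*}
  [NormedAddCommGroup E] [NormedSpace ℝ E] [TopologicalSpace H] {I : ModelWithCorners ℝ E H}
  [TopologicalSpace M] [ChartedSpace H M]
  [NormedAddCommGroup E'] [NormedSpace ℝ E'] [TopologicalSpace H'] {I' : ModelWithCorners ℝ E' H'}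
  [TopologicalSpace M'] [ChartedSpace H' M']
  [NormedAddCommGroup E''] [NormedSpace ℝ E''] [TopologicalSpace H'']
  {I'' : ModelWithCorners ℝ E'' H''} [TopologicalSpace M''] [ChartedSpace H'' M'']

/-- Taking the base point equality as a hypothesis lets identities such as `g * g⁻¹ = 1` be used
without rewriting inside tangent spaces. -/
theorem HasMFDerivAt.comp_of_point {f : M → M'} {g : M' → M''} {x : M} {y : M'}
    {f' : E →L[ℝ] E'} {g' : E' →L[ℝ] E''}
    (hg : HasMFDerivAt I' I'' g y g') (hf : HasMFDerivAt I I' f x f') (h : f x = y) :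
    HasMFDerivAt I I'' (g ∘ f) x (g'.comp f') := by
  subst h
  exact hg.comp x hf

theorem HasMFDerivAt.hasFDerivAt_of_model {f : E → E'} {x : E} {f' : E →L[ℝ] E'}
    (h : HasMFDerivAt 𝓘(ℝ, E) 𝓘(ℝ, E') f x f') : HasFDerivAt f f' x :=
  hasMFDerivAt_iff_hasFDerivAt.1 h

theorem hasMFDerivAt_extChartAt_self [IsManifold I 1 M] (x : M) :
    HasMFDerivAt I 𝓘(ℝ, E) (extChartAt I x) x (.id ℝ E) := by
  have h := (mdifferentiableAt_extChartAt (I := I) (mem_chart_source H x)).hasMFDerivAt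
  rwa [mfderiv_extChartAt_self] at h

theorem hasMFDerivAt_extChartAt_symm_self [IsManifold I 1 M] [I.Boundaryless] (x : M) :
    HasMFDerivAt 𝓘(ℝ, E) I (extChartAt I x).symm (extChartAt I x x) (.id ℝ E) := by
  refine ⟨(continuousAt_extChartAt_symm x), ?_⟩
  have : writtenInExtChartAt 𝓘(ℝ, E) I (extChartAt I x x) (extChartAt I x).symm =ᶠ[𝓝
      (extChartAt I x x)] id := by
    filter_upwards [extChartAt_target_mem_nhds (I := I) x] with y hy
    simp only [writtenInExtChartAt, extChartAt_to_inv, Function.comp_apply,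
      extChartAt_model_space_eq_id, PartialEquiv.refl_symm, PartialEquiv.refl_coe, id_eq]
    exact (extChartAt I x).right_inv hy
  exact ((hasFDerivAt_id _).congr_of_eventuallyEq this).hasFDerivWithinAt

end ChainRule

/-! ### The bracket and the Maurer-Cartan equation on the Lie group -/

section LieGroupGerm

variable {E : Type*} [NormedAddCommGroup E] [NormedSpace ℝ E]
  {G : Type*} [TopologicalSpace G] [ChartedSpace E G] [Group G]

variable (E G) in
/-- The multiplication of `G` in the preferred chart at the identity. -/
noncomputable def mulGerm (x : E × E) : E :=
  extChartAt 𝓘(ℝ, E) (1 : G) ((extChartAt 𝓘(ℝ, E) (1 : G)).symm x.1 *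
    (extChartAt 𝓘(ℝ, E) (1 : G)).symm x.2)

variable (E G) in
/-- The inversion of `G` in the preferred chart at the identity. -/
noncomputable def invGerm (x : E) : E :=
  extChartAt 𝓘(ℝ, E) (1 : G) ((extChartAt 𝓘(ℝ, E) (1 : G)).symm x)⁻¹

variable (E G) in
/-- The coordinates of the identity. -/
noncomputable def oneGerm : E := extChartAt 𝓘(ℝ, E) (1 : G) 1

@[simp] theorem extChartAt_symm_oneGerm :
    (extChartAt 𝓘(ℝ, E) (1 : G)).symm (oneGerm E G) = 1 := extChartAt_to_inv _

variable [LieGroup 𝓘(ℝ, E) ∞ G]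

theorem contMDiffAt_extChartAt_symm (g : G) {y : E} (hy : y ∈ (extChartAt 𝓘(ℝ, E) g).target) :
    ContMDiffAt 𝓘(ℝ, E) 𝓘(ℝ, E) ∞ (extChartAt 𝓘(ℝ, E) g).symm y :=
  (contMDiffOn_extChartAt_symm g).contMDiffAt ((isOpen_extChartAt_target g).mem_nhds hy)

theorem contMDiffAt_extChartAt_of_mem (g : G) {h : G} (hh : h ∈ (extChartAt 𝓘(ℝ, E) g).source) :
    ContMDiffAt 𝓘(ℝ, E) 𝓘(ℝ, E) ∞ (extChartAt 𝓘(ℝ, E) g) h :=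
  contMDiffAt_extChartAt' (by simpa using hh)

variable (E G) in
theorem isGroupGerm : IsGroupGerm (mulGerm E G) (invGerm E G) (oneGerm E G) := by
  have hs : ContMDiffAt 𝓘(ℝ, E) 𝓘(ℝ, E) ∞ (extChartAt 𝓘(ℝ, E) (1 : G)).symm (oneGerm E G) :=
    contMDiffAt_extChartAt_symm _ (mem_extChartAt_target _)
  have ht : ∀ᶠ x in 𝓝 (oneGerm E G), x ∈ (extChartAt 𝓘(ℝ, E) (1 : G)).target :=
    extChartAt_target_mem_nhds _
  refine ⟨?_, ?_, ?_, ?_, ?_, ?_⟩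
  · have h1 : ContMDiffAt 𝓘(ℝ, E × E) 𝓘(ℝ, E) ∞
        (fun x : E × E => (extChartAt 𝓘(ℝ, E) (1 : G)).symm x.1 *
          (extChartAt 𝓘(ℝ, E) (1 : G)).symm x.2) (oneGerm E G, oneGerm E G) :=
      (ContMDiffAt.comp (f := Prod.fst) (oneGerm E G, oneGerm E G) hs
        contDiff_fst.contMDiff.contMDiffAt).mul
      (ContMDiffAt.comp (f := Prod.snd) (oneGerm E G, oneGerm E G) hs
        contDiff_snd.contMDiff.contMDiffAt)
    have h3 := ContMDiffAt.comp (oneGerm E G, oneGerm E G)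
      (contMDiffAt_extChartAt_of_mem (E := E) (1 : G) (by
        simpa only [extChartAt_symm_oneGerm, mul_one] using mem_extChartAt_source (1 : G))) h1
    exact h3.contDiffAt.of_le two_le_infty
  · have h3 := ContMDiffAt.comp (oneGerm E G)
      (contMDiffAt_extChartAt_of_mem (E := E) (1 : G) (by
        simpa only [extChartAt_symm_oneGerm, inv_one] using mem_extChartAt_source (1 : G))) hs.inv
    exact h3.contDiffAt.of_le two_le_infty
  · simp [invGerm, oneGerm]
  · filter_upwards [ht] with x hx
    simp only [mulGerm, extChartAt_symm_oneGerm, mul_one]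
    exact (extChartAt 𝓘(ℝ, E) (1 : G)).right_inv hx
  · filter_upwards [ht] with x hx
    simp only [mulGerm, extChartAt_symm_oneGerm, one_mul]
    exact (extChartAt 𝓘(ℝ, E) (1 : G)).right_inv hx
  · have h1 : ContinuousAt (fun x => ((extChartAt 𝓘(ℝ, E) (1 : G)).symm x)⁻¹) (oneGerm E G) :=
      hs.inv.continuousAt
    have h3 : ∀ᶠ x in 𝓝 (oneGerm E G), ((extChartAt 𝓘(ℝ, E) (1 : G)).symm x)⁻¹ ∈
        (extChartAt 𝓘(ℝ, E) (1 : G)).source :=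
      h1.eventually_mem (by simpa only [extChartAt_symm_oneGerm, inv_one] using
        extChartAt_source_mem_nhds (I := 𝓘(ℝ, E)) (1 : G))
    filter_upwards [h3] with x hx
    simp only [mulGerm, invGerm]
    rw [(extChartAt 𝓘(ℝ, E) (1 : G)).left_inv hx, inv_mul_cancel, oneGerm]

theorem mdifferentiableAt_mul_right_const (g h : G) :
    MDifferentiableAt 𝓘(ℝ, E) 𝓘(ℝ, E) (fun x : G => x * g) h :=
  ((contMDiff_mul_right (I := 𝓘(ℝ, E)) (n := ∞) (a := g)).contMDiffAt).mdifferentiableAt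
    (by simp)

theorem hasMFDerivAt_tangentR (g : G) :
    HasMFDerivAt 𝓘(ℝ, E) 𝓘(ℝ, E) (fun h : G => h * g) 1 (tangentR (E := E) g : E →L[ℝ] E) :=
  (mdifferentiableAt_mul_right_const g 1).hasMFDerivAt

theorem hasMFDerivAt_tangentRInv (g : G) :
    HasMFDerivAt 𝓘(ℝ, E) 𝓘(ℝ, E) (fun h : G => h * g⁻¹) g (tangentRInv (E := E) g : E →L[ℝ] E) :=
  (mdifferentiableAt_mul_right_const g⁻¹ g).hasMFDerivAt

theorem hasMFDerivAt_extChartAt_mul_inv (g : G) :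
    HasMFDerivAt 𝓘(ℝ, E) 𝓘(ℝ, E) (fun h : G => extChartAt 𝓘(ℝ, E) (1 : G) (h * g⁻¹)) g
      (tangentRInv (E := E) g : E →L[ℝ] E) :=
  (hasMFDerivAt_extChartAt_self (I := 𝓘(ℝ, E)) (1 : G)).comp_of_point
    (hasMFDerivAt_tangentRInv g) (mul_inv_cancel g)

/-- The preferred chart at the identity has derivative `id` there, so conjugation and its coordinate
expression have the same derivative; for `s` near `oneGerm` the intermediate products stay in the
chart domain. -/
theorem rightAd_extChartAt_symm : ∀ᶠ s in 𝓝 (oneGerm E G),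
    rightAd E ((extChartAt 𝓘(ℝ, E) (1 : G)).symm s) =
      fderiv ℝ (fun x => mulGerm E G (invGerm E G s, mulGerm E G (x, s))) (oneGerm E G) := by
  have hs : ContMDiffAt 𝓘(ℝ, E) 𝓘(ℝ, E) ∞ (extChartAt 𝓘(ℝ, E) (1 : G)).symm (oneGerm E G) :=
    contMDiffAt_extChartAt_symm _ (mem_extChartAt_target _)
  have h1 : ∀ᶠ x in 𝓝 (oneGerm E G), ((extChartAt 𝓘(ℝ, E) (1 : G)).symm x) ∈
      (extChartAt 𝓘(ℝ, E) (1 : G)).source :=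
    hs.continuousAt.eventually_mem (by
      simpa only [extChartAt_symm_oneGerm] using
        extChartAt_source_mem_nhds (I := 𝓘(ℝ, E)) (1 : G))
  have h2 : ∀ᶠ x in 𝓝 (oneGerm E G), ((extChartAt 𝓘(ℝ, E) (1 : G)).symm x)⁻¹ ∈
      (extChartAt 𝓘(ℝ, E) (1 : G)).source :=
    hs.inv.continuousAt.eventually_mem (by
      simpa only [Pi.inv_apply, extChartAt_symm_oneGerm, inv_one] using
        extChartAt_source_mem_nhds (I := 𝓘(ℝ, E)) (1 : G))
  filter_upwards [h1, h2] with s hs1 hs2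
  set g := (extChartAt 𝓘(ℝ, E) (1 : G)).symm s with hg
  have hd : MDifferentiableAt 𝓘(ℝ, E) 𝓘(ℝ, E) (fun h : G => g⁻¹ * h * g) 1 :=
    ((contMDiffAt_const (c := g⁻¹)).mul contMDiffAt_id |>.mul
      (contMDiffAt_const (c := g))).mdifferentiableAt (n := ∞) (by simp)
  have hA : HasMFDerivAt 𝓘(ℝ, E) 𝓘(ℝ, E) (fun h : G => g⁻¹ * h * g) 1
    (rightAd E g : E →L[ℝ] E) := hd.hasMFDerivAt
  have hB := (hasMFDerivAt_extChartAt_self (I := 𝓘(ℝ, E)) (1 : G)).comp_of_point hA (by simp)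
  have hC : HasFDerivAt _ (rightAd E g) (oneGerm E G) :=
    (hB.comp_of_point (hasMFDerivAt_extChartAt_symm_self (I := 𝓘(ℝ, E)) (1 : G))
      extChartAt_symm_oneGerm).hasFDerivAt_of_model
  have hev : (fun x => mulGerm E G (invGerm E G s, mulGerm E G (x, s))) =ᶠ[𝓝 (oneGerm E G)]
      (extChartAt 𝓘(ℝ, E) (1 : G) ∘ fun h : G => g⁻¹ * h * g) ∘
        (extChartAt 𝓘(ℝ, E) (1 : G)).symm := by
    have h3 : ∀ᶠ x in 𝓝 (oneGerm E G), ((extChartAt 𝓘(ℝ, E) (1 : G)).symm x) * g ∈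
        (extChartAt 𝓘(ℝ, E) (1 : G)).source := by
      refine (hs.mul (contMDiffAt_const (c := g))).continuousAt.eventually_mem ?_
      simp only [Pi.mul_apply, extChartAt_symm_oneGerm, one_mul]
      exact extChartAt_source_mem_nhds' hs1
    filter_upwards [h3] with x hx
    simp only [mulGerm, invGerm, Function.comp_apply]
    rw [← hg, (extChartAt 𝓘(ℝ, E) (1 : G)).left_inv hs2, (extChartAt 𝓘(ℝ, E) (1 : G)).left_inv hx,
      mul_assoc]
  exact (hC.congr_of_eventuallyEq hev).fderiv.symm

theorem ad_apply (ξ η : E) : ad E G ξ η = germBracket (mulGerm E G) (oneGerm E G) ξ η := by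
  have h := (isGroupGerm E G).hasFDerivAt_conj
  rw [← h.2]
  have h1 := (h.1.congr_of_eventuallyEq (rightAd_extChartAt_symm (E := E) (G := G))).hasMFDerivAt
  have h2 := h1.comp_of_point (hasMFDerivAt_extChartAt_self (I := 𝓘(ℝ, E)) (1 : G)) rfl
  have h3 : (fun g : G => rightAd E g) =ᶠ[𝓝 1]
      (fun s => rightAd E ((extChartAt 𝓘(ℝ, E) (1 : G)).symm s)) ∘ extChartAt 𝓘(ℝ, E) (1 : G) := by
    filter_upwards [extChartAt_source_mem_nhds (I := 𝓘(ℝ, E)) (1 : G)] with g hg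
    simp only [Function.comp_apply, (extChartAt 𝓘(ℝ, E) (1 : G)).left_inv hg]
  have h4 := (h2.congr_of_eventuallyEq h3).mfderiv
  exact DFunLike.congr_fun (DFunLike.congr_fun (F := E →L[ℝ] E →L[ℝ] E) h4 ξ) η

theorem ad_swap (ξ η : E) : ad E G ξ η = -ad E G η ξ := by
  rw [ad_apply, ad_apply, germBracket_swap]

/-- The right Maurer-Cartan form of `G` in the preferred chart at `g`. -/
noncomputable def mcForm (g : G) (y : E) : E →L[ℝ] E :=
  (tangentRInv ((extChartAt 𝓘(ℝ, E) g).symm y)).comp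
    (mfderiv 𝓘(ℝ, E) 𝓘(ℝ, E) (extChartAt 𝓘(ℝ, E) g).symm y)

/-- Right translation by `g⁻¹`, from the chart at `g` to the chart at the identity. -/
noncomputable def divGerm (g : G) (z : E) : E :=
  extChartAt 𝓘(ℝ, E) (1 : G) ((extChartAt 𝓘(ℝ, E) g).symm z * g⁻¹)

omit [LieGroup 𝓘(ℝ, E) ∞ G] in
theorem divGerm_self (g : G) : divGerm g (extChartAt 𝓘(ℝ, E) g g) = oneGerm E G := by
  simp [divGerm, oneGerm]

theorem contDiffAt_divGerm (g : G) :
    ContDiffAt ℝ ∞ (divGerm g) (extChartAt 𝓘(ℝ, E) g g) := by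
  have h1 := (contMDiffAt_extChartAt_symm g (mem_extChartAt_target (I := 𝓘(ℝ, E)) g)).mul
    (contMDiffAt_const (c := g⁻¹))
  refine (ContMDiffAt.comp _ (contMDiffAt_extChartAt_of_mem (E := E) (1 : G) ?_) h1).contDiffAt
  simp

theorem hasFDerivAt_mcForm (g : G) {y : E} (hy : y ∈ (extChartAt 𝓘(ℝ, E) g).target) :
    HasFDerivAt (fun z => extChartAt 𝓘(ℝ, E) (1 : G) ((extChartAt 𝓘(ℝ, E) g).symm z *
      ((extChartAt 𝓘(ℝ, E) g).symm y)⁻¹)) (mcForm g y) y :=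
  ((hasMFDerivAt_extChartAt_mul_inv ((extChartAt 𝓘(ℝ, E) g).symm y)).comp y
    ((contMDiffAt_extChartAt_symm g hy).mdifferentiableAt (by simp)).hasMFDerivAt).hasFDerivAt

/-- The Maurer-Cartan form at `y` is the derivative of `z ↦ z y⁻¹` at `z = y`. Since `z y⁻¹ = (z
g⁻¹)(y g⁻¹)⁻¹`, it can be computed with the group law near the identity, even though `g` is
arbitrary. -/
theorem mcForm_eventuallyEq (g : G) : mcForm g =ᶠ[𝓝 (extChartAt 𝓘(ℝ, E) g g)]
    fun y => fderiv ℝ (fun z => mulGerm E G (divGerm g z, invGerm E G (divGerm g y))) y := by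
  have hc := (contMDiffAt_extChartAt_symm g (mem_extChartAt_target (I := 𝓘(ℝ, E)) g)).mul
    (contMDiffAt_const (c := g⁻¹))
  have h1 : ∀ᶠ y in 𝓝 (extChartAt 𝓘(ℝ, E) g g), (extChartAt 𝓘(ℝ, E) g).symm y * g⁻¹ ∈
      (extChartAt 𝓘(ℝ, E) (1 : G)).source :=
    hc.continuousAt.eventually_mem (by
      simpa only [Pi.mul_apply, extChartAt_to_inv, mul_inv_cancel] using
        extChartAt_source_mem_nhds (I := 𝓘(ℝ, E)) (1 : G))
  have h2 : ∀ᶠ y in 𝓝 (extChartAt 𝓘(ℝ, E) g g), ((extChartAt 𝓘(ℝ, E) g).symm y * g⁻¹)⁻¹ ∈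
      (extChartAt 𝓘(ℝ, E) (1 : G)).source :=
    hc.inv.continuousAt.eventually_mem (by
      simpa only [Pi.mul_apply, Pi.inv_apply, extChartAt_to_inv, mul_inv_cancel, inv_one] using
        extChartAt_source_mem_nhds (I := 𝓘(ℝ, E)) (1 : G))
  filter_upwards [h1.eventually_nhds, h2, extChartAt_target_mem_nhds g] with y hy1 hy2 hy
  refine ((hasFDerivAt_mcForm g hy).congr_of_eventuallyEq ?_).fderiv.symm
  filter_upwards [hy1] with z hz
  simp only [mulGerm, invGerm, divGerm]
  rw [(extChartAt 𝓘(ℝ, E) (1 : G)).left_inv hz,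
    (extChartAt 𝓘(ℝ, E) (1 : G)).left_inv hy1.self_of_nhds,
    (extChartAt 𝓘(ℝ, E) (1 : G)).left_inv hy2]
  congr 1
  group

theorem fderiv_divGerm (g : G) : fderiv ℝ (divGerm (E := E) g) (extChartAt 𝓘(ℝ, E) g g) =
    (tangentRInv (E := E) g : E →L[ℝ] E) := by
  have h : HasMFDerivAt 𝓘(ℝ, E) 𝓘(ℝ, E) (divGerm g) (extChartAt 𝓘(ℝ, E) g g)
      ((tangentRInv (E := E) g : E →L[ℝ] E).comp (.id ℝ E)) :=
    (hasMFDerivAt_extChartAt_mul_inv g).comp_of_point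
      (hasMFDerivAt_extChartAt_symm_self g) (extChartAt_to_inv g)
  have key (L : E →L[ℝ] E) (hL : HasFDerivAt (divGerm g) L (extChartAt 𝓘(ℝ, E) g g)) :
      fderiv ℝ (divGerm g) (extChartAt 𝓘(ℝ, E) g g) = L := hL.fderiv
  exact key _ h.hasFDerivAt_of_model

theorem mcForm_self (g : G) : mcForm g (extChartAt 𝓘(ℝ, E) g g) =
    (tangentRInv (E := E) g : E →L[ℝ] E) := by
  rw [← fderiv_divGerm, ← (hasFDerivAt_mcForm g (mem_extChartAt_target g)).fderiv,
    extChartAt_to_inv]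
  rfl

theorem differentiableAt_mcForm (g : G) :
    DifferentiableAt ℝ (mcForm g) (extChartAt 𝓘(ℝ, E) g g) :=
  ((isGroupGerm E G).maurerCartan ((contDiffAt_divGerm g).of_le two_le_infty)
    (divGerm_self g)).1.congr_of_eventuallyEq (mcForm_eventuallyEq g)

/-- The Maurer-Cartan equation. -/
theorem fderiv_mcForm_sub (g : G) (v w : E) :
    fderiv ℝ (mcForm g) (extChartAt 𝓘(ℝ, E) g g) v w
      - fderiv ℝ (mcForm g) (extChartAt 𝓘(ℝ, E) g g) w v =
    -ad E G (tangentRInv g v) (tangentRInv g w) := by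
  rw [(mcForm_eventuallyEq g).fderiv_eq, ((isGroupGerm E G).maurerCartan
    ((contDiffAt_divGerm g).of_le two_le_infty) (divGerm_self g)).2,
    fderiv_divGerm, ad_apply]
  rfl

theorem tangentRInv_tangentR (g : G) (ξ : E) : tangentRInv g (tangentR g ξ) = ξ := by
  have h := (hasMFDerivAt_tangentRInv (E := E) g).comp_of_point
    (hasMFDerivAt_tangentR (E := E) g) (one_mul g)
  have e : (fun h : G => h * g⁻¹) ∘ (fun h : G => h * g) = id := by ext; simp
  rw [e] at h
  exact DFunLike.congr_fun (h.mfderiv.symm.trans mfderiv_id) ξ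

theorem tangentR_tangentRInv (g : G) (v : TangentSpace 𝓘(ℝ, E) g) :
    tangentR g (tangentRInv g v) = v := by
  have h := (hasMFDerivAt_tangentR (E := E) g).comp_of_point (hasMFDerivAt_tangentRInv g)
    (mul_inv_cancel g)
  have e : (fun h : G => h * g) ∘ (fun h : G => h * g⁻¹) = id := by ext; simp
  rw [e] at h
  exact DFunLike.congr_fun (h.mfderiv.symm.trans mfderiv_id) v

end LieGroupGerm

/-! ### The exterior derivative of a one-form in coordinates -/

section ExteriorDerivative

theorem HasFDerivAt.clm_comp_const {X F₁ F₂ F₃ : Type*} [NormedAddCommGroup X] [NormedSpace ℝ X]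
    [NormedAddCommGroup F₁] [NormedSpace ℝ F₁] [NormedAddCommGroup F₂] [NormedSpace ℝ F₂]
    [NormedAddCommGroup F₃] [NormedSpace ℝ F₃] {c : X → F₂ →L[ℝ] F₃} {c' : X →L[ℝ] F₂ →L[ℝ] F₃}
    {x : X} (h : HasFDerivAt c c' x) (L : F₁ →L[ℝ] F₂) :
    HasFDerivAt (fun y => (c y).comp L)
      (((ContinuousLinearMap.compL ℝ F₁ F₂ F₃).flip L).comp c') x :=
  ((ContinuousLinearMap.compL ℝ F₁ F₂ F₃).flip L).hasFDerivAt.comp x h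

variable {E H M : Type*} [NormedAddCommGroup E] [NormedSpace ℝ E] [TopologicalSpace H]
  {I : ModelWithCorners ℝ E H} [TopologicalSpace M] [ChartedSpace H M]

theorem OneForm.d_eq [IsManifold I 1 M] [I.Boundaryless] {θ : OneForm I (M := M)} {p : M}
    {α : E → E →L[ℝ] ℝ} {α' : E →L[ℝ] E →L[ℝ] ℝ}
    (hα : OneForm.inChart I θ p =ᶠ[𝓝 (extChartAt I p p)] α)
    (hα' : HasFDerivAt α α' (extChartAt I p p)) (v w : E) :
    OneForm.d I θ p v w = α' v w - α' w v := by
  have h1 : HasFDerivAt (fun y => ContinuousAlternatingMap.ofSubsingleton ℝ E ℝ (0 : Fin 1)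
      (OneForm.inChart I θ p y))
      ((ContinuousAlternatingMap.ofSubsingletonLIE (𝕜 := ℝ) (E := E) (F := ℝ)
        (0 : Fin 1)).toContinuousLinearEquiv.toContinuousLinearMap.comp α') (extChartAt I p p) :=
    (ContinuousAlternatingMap.ofSubsingletonLIE (𝕜 := ℝ) (E := E) (F := ℝ)
      (0 : Fin 1)).toContinuousLinearEquiv.toContinuousLinearMap.hasFDerivAt.comp _
        (hα'.congr_of_eventuallyEq hα)
  have h2 : OneForm.d I θ p v w = extDerivWithin (fun y =>
      ContinuousAlternatingMap.ofSubsingleton ℝ E ℝ (0 : Fin 1) (OneForm.inChart I θ p y))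
      (Set.range I) (extChartAt I p p) ![v, w] := by
    unfold OneForm.d
    rw [mfderiv_extChartAt_self]
    rfl
  rw [h2, I.range_eq_univ, extDerivWithin_univ, extDeriv, h1.fderiv,
    ContinuousAlternatingMap.alternatizeUncurryFin_apply]
  simp [Fin.sum_univ_two, sub_eq_add_neg]
  rfl

end ExteriorDerivative

/-! ### Explicit formulas for `dθ` and `dθ₁` -/

section Forms

variable {E : Type*} [NormedAddCommGroup E] [NormedSpace ℝ E]
  {G : Type*} [TopologicalSpace G] [ChartedSpace E G] [Group G] [LieGroup 𝓘(ℝ, E) ∞ G]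

theorem hasMFDerivAt_extChartAt_symm_modelB (q : TrivB E G) {y : E × StrongDual ℝ E}
    (hy : y.1 ∈ (extChartAt 𝓘(ℝ, E) q.1).target) :
    HasMFDerivAt 𝓘(ℝ, E × StrongDual ℝ E) (modelB E) (extChartAt (modelB E) q).symm y
      (((mfderiv 𝓘(ℝ, E) 𝓘(ℝ, E) (extChartAt 𝓘(ℝ, E) q.1).symm y.1 : E →L[ℝ] E).comp
        (.fst ℝ E (StrongDual ℝ E))).prod (.snd ℝ E (StrongDual ℝ E))) := by
  have h1 : HasMFDerivAt 𝓘(ℝ, E × StrongDual ℝ E) 𝓘(ℝ, E)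
      (Prod.fst : E × StrongDual ℝ E → E) y (.fst ℝ E (StrongDual ℝ E)) :=
    hasFDerivAt_fst.hasMFDerivAt
  have h2 : HasMFDerivAt 𝓘(ℝ, E × StrongDual ℝ E) 𝓘(ℝ, StrongDual ℝ E)
      (Prod.snd : E × StrongDual ℝ E → StrongDual ℝ E) y (.snd ℝ E (StrongDual ℝ E)) :=
    hasFDerivAt_snd.hasMFDerivAt
  have h3 := ((contMDiffAt_extChartAt_symm q.1 hy).mdifferentiableAt (by simp)).hasMFDerivAt
  exact (HasMFDerivAt.comp y h3 h1).prodMk h2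

theorem inChart_thetaB (q : TrivB E G) {y : E × StrongDual ℝ E}
    (hy : y.1 ∈ (extChartAt 𝓘(ℝ, E) q.1).target) :
    OneForm.inChart (modelB E) thetaB q y =
      (y.2.comp (mcForm q.1 y.1)).comp (.fst ℝ E (StrongDual ℝ E)) := by
  rw [OneForm.inChart, ModelWithCorners.range_eq_univ, mfderivWithin_univ,
    (hasMFDerivAt_extChartAt_symm_modelB q hy).mfderiv]
  rfl

theorem tangentRInv_eq_mcForm (g : G) (v : E) :
    tangentRInv g v = mcForm g (extChartAt 𝓘(ℝ, E) g g) v := by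
  rw [mcForm_self]
  rfl

theorem hasFDerivAt_comp_mcForm (g : G) (μ : StrongDual ℝ E) :
    HasFDerivAt (fun y : E × StrongDual ℝ E => y.2.comp (mcForm g y.1))
    ((ContinuousLinearMap.compL ℝ E E ℝ μ).comp
      ((fderiv ℝ (mcForm g) (extChartAt 𝓘(ℝ, E) g g)).comp (.fst ℝ E (StrongDual ℝ E))) +
     ((ContinuousLinearMap.compL ℝ E E ℝ).flip (mcForm g (extChartAt 𝓘(ℝ, E) g g))).comp
      (.snd ℝ E (StrongDual ℝ E))) (extChartAt 𝓘(ℝ, E) g g, μ) := by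
  exact HasFDerivAt.clm_comp (x := (extChartAt 𝓘(ℝ, E) g g, μ)) (𝕜 := ℝ)
    (c := fun y : E × StrongDual ℝ E => y.2) (d := fun y : E × StrongDual ℝ E => mcForm g y.1)
    hasFDerivAt_snd ((differentiableAt_mcForm g).hasFDerivAt.comp (𝕜 := ℝ)
      (extChartAt 𝓘(ℝ, E) g g, μ) (f := Prod.fst) hasFDerivAt_fst)

omit [Group G] [LieGroup 𝓘(ℝ, E) ∞ G] in
theorem eventually_mem_target (q : TrivB E G) : ∀ᶠ y in 𝓝 (extChartAt (modelB E) q q),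
    y.1 ∈ (extChartAt 𝓘(ℝ, E) q.1).target :=
  continuousAt_fst.eventually_mem (extChartAt_target_mem_nhds (I := 𝓘(ℝ, E)) q.1)

theorem d_thetaB (q : TrivB E G) (v w : E × StrongDual ℝ E) :
    OneForm.d (modelB E) thetaB q v w = v.2 (tangentRInv q.1 w.1) - w.2 (tangentRInv q.1 v.1)
      - q.2 (ad E G (tangentRInv q.1 v.1) (tangentRInv q.1 w.1)) := by
  have h1 : OneForm.inChart (modelB E) thetaB q =ᶠ[𝓝 (extChartAt (modelB E) q q)] _ :=
    (eventually_mem_target q).mono fun y hy => inChart_thetaB q hy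
  have h2 := (hasFDerivAt_comp_mcForm q.1 q.2).clm_comp_const (.fst ℝ E (StrongDual ℝ E))
  -- The Maurer-Cartan equation is used backwards: the bracket is expanded into derivatives of
  -- `mcForm`, after which both sides agree term by term.
  rw [OneForm.d_eq h1 h2, ← neg_eq_iff_eq_neg.2 (fderiv_mcForm_sub q.1 v.1 w.1), map_neg, map_sub,
    tangentRInv_eq_mcForm, tangentRInv_eq_mcForm]
  simp
  ring

/-- The coadjoint term of the trivialization and the explicit bracket term cancel by antisymmetry,
so `μ` drops out. -/
theorem theta1_apply' (p : TrivTT E G) (v : (E × StrongDual ℝ E) × (E × StrongDual ℝ E)) :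
    theta1 p v = p.2.2 (tangentRInv p.1.1 v.1.1) - v.1.2 p.2.1 := by
  obtain ⟨⟨g, μ⟩, ξ, ν⟩ := p
  obtain ⟨⟨V, m⟩, x⟩ := v
  rw [theta1_apply, ad_swap, map_neg, sub_apply, coad_apply]
  ring

theorem hasMFDerivAt_extChartAt_symm_modelTT (p : TrivTT E G)
    {y : (E × StrongDual ℝ E) × (E × StrongDual ℝ E)}
    (hy : y.1.1 ∈ (extChartAt 𝓘(ℝ, E) p.1.1).target) :
    HasMFDerivAt 𝓘(ℝ, (E × StrongDual ℝ E) × (E × StrongDual ℝ E)) (modelTT E)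
      (extChartAt (modelTT E) p).symm y
      (((((mfderiv 𝓘(ℝ, E) 𝓘(ℝ, E) (extChartAt 𝓘(ℝ, E) p.1.1).symm y.1.1 : E →L[ℝ] E).comp
        (.fst ℝ E (StrongDual ℝ E))).prod (.snd ℝ E (StrongDual ℝ E))).comp
        (.fst ℝ (E × StrongDual ℝ E) (E × StrongDual ℝ E))).prod
        (.snd ℝ (E × StrongDual ℝ E) (E × StrongDual ℝ E))) := by
  have h1 : HasMFDerivAt 𝓘(ℝ, (E × StrongDual ℝ E) × (E × StrongDual ℝ E))
      𝓘(ℝ, E × StrongDual ℝ E)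
      (Prod.fst : (E × StrongDual ℝ E) × (E × StrongDual ℝ E) → _) y
      (.fst ℝ (E × StrongDual ℝ E) (E × StrongDual ℝ E)) :=
    hasFDerivAt_fst.hasMFDerivAt
  have h2 : HasMFDerivAt 𝓘(ℝ, (E × StrongDual ℝ E) × (E × StrongDual ℝ E))
      𝓘(ℝ, E × StrongDual ℝ E)
      (Prod.snd : (E × StrongDual ℝ E) × (E × StrongDual ℝ E) → _) y
      (.snd ℝ (E × StrongDual ℝ E) (E × StrongDual ℝ E)) :=
    hasFDerivAt_snd.hasMFDerivAt
  exact (HasMFDerivAt.comp y (hasMFDerivAt_extChartAt_symm_modelB p.1 hy) h1).prodMk h2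

theorem inChart_theta1 (p : TrivTT E G) {y : (E × StrongDual ℝ E) × (E × StrongDual ℝ E)}
    (hy : y.1.1 ∈ (extChartAt 𝓘(ℝ, E) p.1.1).target) :
    OneForm.inChart (modelTT E) theta1 p y =
      ((y.2.2.comp (mcForm p.1.1 y.1.1)).comp (.fst ℝ E (StrongDual ℝ E)) -
        (NormedSpace.inclusionInDoubleDual ℝ E y.2.1).comp (.snd ℝ E (StrongDual ℝ E))).comp
      (.fst ℝ (E × StrongDual ℝ E) (E × StrongDual ℝ E)) := by
  rw [OneForm.inChart, ModelWithCorners.range_eq_univ, mfderivWithin_univ,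
    (hasMFDerivAt_extChartAt_symm_modelTT p hy).mfderiv]
  refine ContinuousLinearMap.ext fun v => ?_
  exact theta1_apply' _ _

theorem d_theta1 (p : TrivTT E G) (v w : (E × StrongDual ℝ E) × (E × StrongDual ℝ E)) :
    OneForm.d (modelTT E) theta1 p v w =
      v.2.2 (tangentRInv p.1.1 w.1.1) - w.2.2 (tangentRInv p.1.1 v.1.1)
      - p.2.2 (ad E G (tangentRInv p.1.1 v.1.1) (tangentRInv p.1.1 w.1.1))
      + v.1.2 w.2.1 - w.1.2 v.2.1 := by
  have h1 : OneForm.inChart (modelTT E) theta1 p =ᶠ[𝓝 (extChartAt (modelTT E) p p)] _ :=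
    (continuousAt_fst.eventually (eventually_mem_target p.1)).mono fun y hy => inChart_theta1 p hy
  have h2 := (hasFDerivAt_comp_mcForm p.1.1 p.2.2).comp
    (x := (((extChartAt 𝓘(ℝ, E) p.1.1 p.1.1, p.1.2), p.2) :
      (E × StrongDual ℝ E) × (E × StrongDual ℝ E)))
    (f := fun y => (y.1.1, y.2.2)) ((hasFDerivAt_fst.comp (𝕜 := ℝ) _ hasFDerivAt_fst).prodMk
      (hasFDerivAt_snd.comp (𝕜 := ℝ) _ hasFDerivAt_snd))
  have h3 : HasFDerivAt (fun y : (E × StrongDual ℝ E) × (E × StrongDual ℝ E) =>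
      NormedSpace.inclusionInDoubleDual ℝ E y.2.1) _
      (((extChartAt 𝓘(ℝ, E) p.1.1 p.1.1, p.1.2), p.2) :
        (E × StrongDual ℝ E) × (E × StrongDual ℝ E)) :=
    ((NormedSpace.inclusionInDoubleDual ℝ E).comp
      ((ContinuousLinearMap.fst ℝ E (StrongDual ℝ E)).comp
        (.snd ℝ (E × StrongDual ℝ E) (E × StrongDual ℝ E)))).hasFDerivAt
  have h4 := ((h2.clm_comp_const (.fst ℝ E (StrongDual ℝ E))).sub
    (h3.clm_comp_const (.snd ℝ E (StrongDual ℝ E)))).clm_comp_const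
      (.fst ℝ (E × StrongDual ℝ E) (E × StrongDual ℝ E))
  rw [OneForm.d_eq h1 h4, ← neg_eq_iff_eq_neg.2 (fderiv_mcForm_sub p.1.1 v.1.1 w.1.1), map_neg,
    map_sub, tangentRInv_eq_mcForm, tangentRInv_eq_mcForm]
  simp
  ring

end Forms

/-! ### Smooth dependence of partial derivatives on parameters -/

section PartialDerivative

theorem ContMDiffAt.fderiv_partial {B H N F F' : Type*} [NormedAddCommGroup B] [NormedSpace ℝ B]
    [TopologicalSpace H] {J : ModelWithCorners ℝ B H} [TopologicalSpace N] [ChartedSpace H N]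
    [IsManifold J ∞ N]
    [NormedAddCommGroup F] [NormedSpace ℝ F] [NormedAddCommGroup F'] [NormedSpace ℝ F']
    {f : N → F → F'} {g : N → F} {x : N}
    (hf : ContMDiffAt (J.prod 𝓘(ℝ, F)) 𝓘(ℝ, F') ∞ (Function.uncurry f) (x, g x))
    (hg : ContMDiffAt J 𝓘(ℝ, F) ∞ g x) :
    ContMDiffAt J 𝓘(ℝ, F →L[ℝ] F') ∞ (fun y => fderiv ℝ (f y) (g y)) x := by
  -- On vector spaces the tangent coordinate changes are trivial, so the manifold statement is the
  -- one about `fderiv`.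
  refine (ContMDiffAt.mfderiv f g hf hg (by simp)).congr_of_eventuallyEq
    (Eventually.of_forall fun y => ?_)
  exact mfderiv_eq_fderiv.symm.trans (congrFun (inTangentCoordinates_model_space
    (I := 𝓘(ℝ, F)) (I' := 𝓘(ℝ, F')) g
    (fun y => f y (g y)) (fun y => mfderiv 𝓘(ℝ, F) 𝓘(ℝ, F') (f y) (g y)) x) y).symm

end PartialDerivative

/-! ### The set `-(¹τ)^* dH = θ₁` as the graph of a smooth section -/

section Hamiltonian

variable {E : Type*} [NormedAddCommGroup E] [NormedSpace ℝ E]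
  {G : Type*} [TopologicalSpace G] [ChartedSpace E G]

theorem eq_of_forall_strongDual_eq {x y : E} (h : ∀ m : StrongDual ℝ E, m x = m y) : x = y :=
  (SeparatingDual.eq_iff_forall_dual_eq (R := ℝ)).2 h

omit [TopologicalSpace G] [ChartedSpace E G] in
theorem apply_deltaMu [IsReflexiveSpace E] (H : TrivB E G → ℝ) (q : TrivB E G)
    (m : StrongDual ℝ E) :
    m (deltaMu H q) = fderiv ℝ (fun μ : StrongDual ℝ E => H (q.1, μ)) q.2 m := by
  exact DFunLike.congr_fun (Function.surjInv_eq (IsReflexiveSpace.surjective (E := E)) _) m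

variable (E) in
/-- The canonical isometry of a reflexive space with its bidual. -/
noncomputable def bidualEquiv [IsReflexiveSpace E] :
    E ≃ₗᵢ[ℝ] StrongDual ℝ (StrongDual ℝ E) :=
  LinearIsometryEquiv.ofSurjective (NormedSpace.inclusionInDoubleDualLi ℝ)
    IsReflexiveSpace.surjective

-- The preimage chosen in `deltaMu` is thereby given by a continuous linear map, which is what makes
-- it smooth in `q`.
omit [TopologicalSpace G] [ChartedSpace E G] in
theorem deltaMu_eq [IsReflexiveSpace E] (H : TrivB E G → ℝ) (q : TrivB E G) :
    deltaMu H q = (bidualEquiv E).symm (fderiv ℝ (fun μ : StrongDual ℝ E => H (q.1, μ)) q.2) := by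
  rw [LinearIsometryEquiv.eq_symm_apply]
  exact Function.surjInv_eq _ _

variable {H : TrivB E G → ℝ} (hH : ContMDiff (modelB E) 𝓘(ℝ, ℝ) ∞ H)
include hH

theorem dOneForm_apply [IsReflexiveSpace E] (q : TrivB E G) (v : E × StrongDual ℝ E) :
    dOneForm (modelB E) H q v = deltaG H q v.1 + v.2 (deltaMu H q) := by
  rw [apply_deltaMu, ← mfderiv_eq_fderiv]
  exact mfderiv_prod_eq_add_apply ((hH q).mdifferentiableAt (by simp))

variable [Group G]

theorem contMDiff_deltaMu [IsReflexiveSpace E] [LieGroup 𝓘(ℝ, E) ∞ G] :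
    ContMDiff (modelB E) 𝓘(ℝ, E) ∞ (deltaMu H) := by
  intro q
  have h := ContMDiffAt.fderiv_partial (J := modelB E) (x := q)
    (f := fun (q : TrivB E G) (μ : StrongDual ℝ E) => H (q.1, μ)) (g := Prod.snd)
    ((hH _).comp _ (contMDiffAt_fst.fst.prodMk contMDiffAt_snd)) contMDiffAt_snd
  have h2 := ((bidualEquiv E).symm.toContinuousLinearEquiv.contDiff.contMDiff
    (n := ∞)).contMDiffAt.comp q h
  refine h2.congr_of_eventuallyEq (Eventually.of_forall fun q => ?_)
  rw [deltaMu_eq]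
  rfl

/-- Moving the variation of `g` to the identity makes the covector a partial derivative at the fixed
point `oneGerm` of a fixed vector space, so `ContMDiffAt.fderiv_partial` applies to it. -/
theorem hasFDerivAt_pulledDeltaG [LieGroup 𝓘(ℝ, E) ∞ G] (q : TrivB E G) :
    HasFDerivAt (fun x => H ((extChartAt 𝓘(ℝ, E) (1 : G)).symm x * q.1, q.2)) (pulledDeltaG H q)
      (oneGerm E G) := by
  have h1 : HasMFDerivAt 𝓘(ℝ, E) 𝓘(ℝ, ℝ) (fun h : G => H (h, q.2)) q.1 (deltaG H q) :=
    (((hH _).comp q.1 (contMDiffAt_id.prodMk contMDiffAt_const)).mdifferentiableAt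
      (by simp)).hasMFDerivAt
  exact ((h1.comp_of_point (hasMFDerivAt_tangentR q.1) (one_mul q.1)).comp_of_point
    (hasMFDerivAt_extChartAt_symm_self (I := 𝓘(ℝ, E)) (1 : G))
      extChartAt_symm_oneGerm).hasFDerivAt_of_model

theorem contMDiff_pulledDeltaG [LieGroup 𝓘(ℝ, E) ∞ G] :
    ContMDiff (modelB E) 𝓘(ℝ, StrongDual ℝ E) ∞ (pulledDeltaG H) := by
  intro q
  have hs : ContMDiffAt 𝓘(ℝ, E) 𝓘(ℝ, E) ∞ (extChartAt 𝓘(ℝ, E) (1 : G)).symm (oneGerm E G) :=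
    contMDiffAt_extChartAt_symm _ (mem_extChartAt_target _)
  have h := ContMDiffAt.fderiv_partial (J := modelB E) (x := q)
    (f := fun (q : TrivB E G) (x : E) => H ((extChartAt 𝓘(ℝ, E) (1 : G)).symm x * q.1, q.2))
    (g := fun _ => oneGerm E G)
    ((hH _).comp _ (((hs.comp (q, oneGerm E G) contMDiffAt_snd).mul contMDiffAt_fst.fst).prodMk
      contMDiffAt_fst.snd)) contMDiffAt_const
  refine h.congr_of_eventuallyEq (Eventually.of_forall fun q => ?_)
  rw [← (hasFDerivAt_pulledDeltaG hH q).fderiv]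

omit hH in
/-- The map `(g, μ) ↦ (δH/δμ, -T^* R_g (δH/δg))`. -/
noncomputable def hamiltonianSection [IsReflexiveSpace E] (H : TrivB E G → ℝ) (q : TrivB E G) :
    E × StrongDual ℝ E :=
  (deltaMu H q, -pulledDeltaG H q)

theorem contMDiff_hamiltonianSection [IsReflexiveSpace E] [LieGroup 𝓘(ℝ, E) ∞ G] :
    ContMDiff (modelB E) 𝓘(ℝ, E × StrongDual ℝ E) ∞ (hamiltonianSection H) :=
  (contMDiff_deltaMu hH).prodMk_space (contMDiff_pulledDeltaG hH).neg

theorem mem_hamiltonianSet_iff [IsReflexiveSpace E] [LieGroup 𝓘(ℝ, E) ∞ G] (p : TrivTT E G) :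
    p ∈ hamiltonianSet H ↔ p.2 = hamiltonianSection H p.1 := by
  have h1 (v : (E × StrongDual ℝ E) × (E × StrongDual ℝ E)) :
      -(OneForm.pullback (modelTT E) (modelB E) tau (dOneForm (modelB E) H) p) v =
        -(deltaG H p.1 v.1.1 + v.1.2 (deltaMu H p.1)) := by
    rw [← dOneForm_apply hH]
    have : mfderiv (modelTT E) (modelB E) (tau : TrivTT E G → TrivB E G) p =
      .fst ℝ (E × StrongDual ℝ E) (E × StrongDual ℝ E) := mfderiv_fst
    rw [OneForm.pullback, this]
    rfl
  constructor
  · intro h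
    have h2 (v : (E × StrongDual ℝ E) × (E × StrongDual ℝ E)) :
        -(deltaG H p.1 v.1.1 + v.1.2 (deltaMu H p.1)) =
          p.2.2 (tangentRInv p.1.1 v.1.1) - v.1.2 p.2.1 := by
      rw [← h1, ← theta1_apply']
      exact DFunLike.congr_fun h v
    -- Vectors `(0, m)` isolate `ξ`; vectors `(T R_g ζ, 0)` isolate `ν`.
    refine Prod.ext (eq_of_forall_strongDual_eq fun m => ?_) ?_
    · have := h2 ((0, m), 0)
      have e1 : tangentRInv (E := E) p.1.1 (0 : E) = 0 := map_zero _
      have e2 : deltaG H p.1 (0 : E) = 0 := map_zero _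
      simp only [e1, e2, map_zero, zero_add, zero_sub, neg_inj] at this
      exact this.symm
    · ext ζ
      have := h2 ((tangentR p.1.1 ζ, 0), 0)
      rw [tangentRInv_tangentR] at this
      simp only [zero_apply, add_zero, sub_zero] at this
      exact this.symm
  · intro h
    change -(OneForm.pullback (modelTT E) (modelB E) tau (dOneForm (modelB E) H) p) = theta1 p
    refine ContinuousLinearMap.ext fun v => ?_
    refine (h1 v).trans ((theta1_apply' p v).trans ?_).symm
    rw [h]
    have : pulledDeltaG H p.1 (tangentRInv p.1.1 v.1.1) = deltaG H p.1 v.1.1 :=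
      congrArg (deltaG H p.1) (tangentR_tangentRInv p.1.1 v.1.1)
    change -(pulledDeltaG H p.1 (tangentRInv p.1.1 v.1.1)) - _ = _
    rw [this, neg_add, sub_eq_add_neg]
    rfl

end Hamiltonian

/-! ### Nondegeneracy, the Hamiltonian vector field and Hamilton's equations -/

section Symplectic

variable {E : Type*} [NormedAddCommGroup E] [NormedSpace ℝ E]
  {G : Type*} [TopologicalSpace G] [ChartedSpace E G] [Group G] [LieGroup 𝓘(ℝ, E) ∞ G]

theorem eq_of_tangentRInv_eq {g : G} {v w : E}
    (h : tangentRInv (E := E) g v = tangentRInv (E := E) g w) : v = w :=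
  (tangentR_tangentRInv g v).symm.trans
    ((congrArg (tangentR (E := E) g) h).trans (tangentR_tangentRInv g w))

variable (E G) in
theorem isSymplecticPotential_theta1 :
    IsSymplecticPotential (modelTT E) (theta1 : OneForm (modelTT E) (M := TrivTT E G)) := by
  intro p v h
  have h' (w : (E × StrongDual ℝ E) × (E × StrongDual ℝ E)) := (d_theta1 p v w).symm.trans (h w)
  obtain ⟨⟨V, m⟩, ξ, n⟩ : (E × StrongDual ℝ E) × (E × StrongDual ℝ E) := v
  have z : tangentRInv (E := E) p.1.1 (0 : E) = 0 := map_zero _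
  have hV : V = 0 := by
    refine eq_of_tangentRInv_eq (g := p.1.1) (eq_of_forall_strongDual_eq fun n' => ?_)
    have := h' ((0, 0), (0, n'))
    simpa [z] using this
  have hξ : ξ = 0 := by
    refine eq_of_forall_strongDual_eq fun m' => ?_
    have := h' ((0, m'), (0, 0))
    simpa [z] using this
  have hm : m = 0 := by
    ext ξ'
    have := h' ((0, 0), (ξ', 0))
    simpa [z] using this
  -- With `V = 0` the bracket term disappears, so the remaining test vectors see only `n`.
  subst hV hξ hm
  have hn : n = 0 := by
    ext ζ
    have := h' ((tangentR p.1.1 ζ, 0), (0, 0))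
    simp only [tangentRInv_tangentR] at this
    simpa [z] using this
  subst hn
  rfl

/-- The vector field of Hamilton's equations. -/
noncomputable def hamiltonianField [IsReflexiveSpace E] (H : TrivB E G → ℝ) (q : TrivB E G) :
    E × StrongDual ℝ E :=
  (tangentR q.1 (deltaMu H q), coad G q.2 (deltaMu H q) - pulledDeltaG H q)

variable [IsReflexiveSpace E] {H : TrivB E G → ℝ} (hH : ContMDiff (modelB E) 𝓘(ℝ, ℝ) ∞ H)

omit [IsReflexiveSpace E] in
theorem eq_of_d_thetaB_eq {q : TrivB E G} {v v' : E × StrongDual ℝ E}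
    (h : ∀ w : E × StrongDual ℝ E, OneForm.d (modelB E) thetaB q v w =
      OneForm.d (modelB E) thetaB q v' w) : v = v' := by
  have h' (w : E × StrongDual ℝ E) :=
    (d_thetaB q v w).symm.trans ((h w).trans (d_thetaB q v' w))
  obtain ⟨V, m⟩ := v
  obtain ⟨V', m'⟩ := v'
  have z : tangentRInv (E := E) q.1 (0 : E) = 0 := map_zero _
  have hV : V = V' := by
    refine eq_of_tangentRInv_eq (g := q.1) (eq_of_forall_strongDual_eq fun n' => ?_)
    have := h' (0, n')
    simpa [z] using this
  subst hV
  have hm : m = m' := by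
    ext ζ
    have := h' (tangentR q.1 ζ, 0)
    simp only [tangentRInv_tangentR] at this
    simpa using this
  rw [hm]

-- The coadjoint term in the second component of the field cancels the bracket term of `Ω`, leaving
-- the two partial derivatives of `H`.
include hH in
theorem d_thetaB_hamiltonianField (q : TrivB E G) (w : E × StrongDual ℝ E) :
    OneForm.d (modelB E) thetaB q (hamiltonianField H q) w = -(dOneForm (modelB E) H q w) := by
  refine (d_thetaB q (hamiltonianField H q) w).trans ?_
  rw [dOneForm_apply hH]
  have h1 : pulledDeltaG H q (tangentRInv q.1 w.1) = deltaG H q w.1 :=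
    congrArg (deltaG H q) (tangentR_tangentRInv q.1 w.1)
  have h2 : tangentRInv q.1 (hamiltonianField H q).1 = deltaMu H q := tangentRInv_tangentR _ _
  rw [h2, ← h1]
  change coad G q.2 (deltaMu H q) (tangentRInv q.1 w.1) - pulledDeltaG H q (tangentRInv q.1 w.1)
    - _ - _ = _
  rw [coad_apply]
  ring

include hH in
theorem isHamiltonianVectorField_iff (Y : ∀ q : TrivB E G, TangentSpace (modelB E) q) :
    IsHamiltonianVectorField H Y ↔ Y = hamiltonianField H := by
  constructor
  · intro h
    funext q
    exact eq_of_d_thetaB_eq (q := q) fun w =>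
      (h q w).trans (d_thetaB_hamiltonianField hH q w).symm
  · rintro rfl q w
    exact d_thetaB_hamiltonianField hH q w

omit [LieGroup 𝓘(ℝ, E) ∞ G] in
theorem reconstruct_hamiltonianSection (q : TrivB E G) :
    reconstruct (q, hamiltonianSection H q) = ⟨q, hamiltonianField H q⟩ := by
  have : -pulledDeltaG H q + coad G q.2 (deltaMu H q) =
    coad G q.2 (deltaMu H q) - pulledDeltaG H q := by abel
  simp only [reconstruct, hamiltonianSection, hamiltonianField, this]

include hH in
theorem reconstruct_image_hamiltonianSet :
    reconstruct '' hamiltonianSet H = Set.range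
      (fun q : TrivB E G =>
        (⟨q, hamiltonianField H q⟩ : TangentBundle (modelB E) (TrivB E G))) := by
  ext x
  constructor
  · rintro ⟨p, hp, rfl⟩
    refine ⟨p.1, ?_⟩
    refine (reconstruct_hamiltonianSection p.1).symm.trans ?_
    rw [← (mem_hamiltonianSet_iff hH p).1 hp]
  · rintro ⟨q, rfl⟩
    exact ⟨(q, hamiltonianSection H q), (mem_hamiltonianSet_iff hH _).2 rfl,
      reconstruct_hamiltonianSection q⟩

include hH in
theorem velocity_mem_iff {γ : ℝ → TrivB E G} {t : ℝ}
    (hγ : MDifferentiableAt 𝓘(ℝ, ℝ) (modelB E) γ t) :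
    velocity γ t ∈ reconstruct '' hamiltonianSet H ↔ SolvesHamiltonAt H γ t := by
  have h1 : HasMFDerivAt 𝓘(ℝ, ℝ) 𝓘(ℝ, E) (fun s => (γ s).1) t
      ((ContinuousLinearMap.fst ℝ E (StrongDual ℝ E)).comp
        (mfderiv 𝓘(ℝ, ℝ) (modelB E) γ t : ℝ →L[ℝ] E × StrongDual ℝ E)) :=
    (hasMFDerivAt_fst (γ t)).comp t hγ.hasMFDerivAt
  have h2 : HasMFDerivAt 𝓘(ℝ, ℝ) 𝓘(ℝ, StrongDual ℝ E) (fun s => (γ s).2) t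
      ((ContinuousLinearMap.snd ℝ E (StrongDual ℝ E)).comp
        (mfderiv 𝓘(ℝ, ℝ) (modelB E) γ t : ℝ →L[ℝ] E × StrongDual ℝ E)) :=
    (hasMFDerivAt_snd (γ t)).comp t hγ.hasMFDerivAt
  have h3 : deriv (fun s => (γ s).2) t =
      (mfderiv 𝓘(ℝ, ℝ) (modelB E) γ t (1 : ℝ) : E × StrongDual ℝ E).2 :=
    (h2.hasFDerivAt_of_model.hasDerivAt).deriv
  rw [SolvesHamiltonAt, h3, h1.mfderiv, reconstruct_image_hamiltonianSet hH]
  constructor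
  · rintro ⟨q, hq⟩
    obtain rfl : q = γ t := congrArg Bundle.TotalSpace.proj hq
    have := eq_of_heq (Bundle.TotalSpace.mk.inj hq).2
    exact ⟨(congrArg Prod.fst this).symm, (congrArg Prod.snd this).symm⟩
  · rintro ⟨ha, hb⟩
    refine ⟨γ t, ?_⟩
    have : (mfderiv 𝓘(ℝ, ℝ) (modelB E) γ t (1 : ℝ) : E × StrongDual ℝ E) =
      hamiltonianField H (γ t) := Prod.ext ha hb
    exact congrArg (Bundle.TotalSpace.mk (γ t)) this.symm

end Symplectic

/-! ### The graph is a Lagrangian submanifold -/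

section Lagrangian

theorem HasFDerivAt.continuousLinearMap_apply {X Y Z : Type*} [NormedAddCommGroup X]
    [NormedSpace ℝ X] [NormedAddCommGroup Y] [NormedSpace ℝ Y] [NormedAddCommGroup Z]
    [NormedSpace ℝ Z] {f : X → Y} {f' : X →L[ℝ] Y} {x : X} (h : HasFDerivAt f f' x)
    (L : Y →L[ℝ] Z) : HasFDerivAt (fun y => L (f y)) (L.comp f') x :=
  L.hasFDerivAt.comp x h

variable {E : Type*} [NormedAddCommGroup E] [NormedSpace ℝ E]
  {G : Type*} [TopologicalSpace G] [ChartedSpace E G] [Group G] [LieGroup 𝓘(ℝ, E) ∞ G]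
  [IsReflexiveSpace E] {H : TrivB E G → ℝ} (hH : ContMDiff (modelB E) 𝓘(ℝ, ℝ) ∞ H)

/-- The derivative of the Hamiltonian section. -/
noncomputable def hamiltonianSectionDeriv (H : TrivB E G → ℝ) (q : TrivB E G) :
    E × StrongDual ℝ E →L[ℝ] E × StrongDual ℝ E :=
  mfderiv (modelB E) 𝓘(ℝ, E × StrongDual ℝ E) (hamiltonianSection H) q

include hH

theorem hasMFDerivAt_hamiltonianSection (q : TrivB E G) :
    HasMFDerivAt (modelB E) 𝓘(ℝ, E × StrongDual ℝ E) (hamiltonianSection H) q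
      (hamiltonianSectionDeriv H q) :=
  ((contMDiff_hamiltonianSection hH q).mdifferentiableAt (by simp)).hasMFDerivAt

theorem hasFDerivAt_hamiltonianSection_chart (q : TrivB E G) :
    HasFDerivAt (hamiltonianSection H ∘ (extChartAt (modelB E) q).symm)
      (hamiltonianSectionDeriv H q) (extChartAt (modelB E) q q) :=
  ((hasMFDerivAt_hamiltonianSection hH q).comp_of_point
    (hasMFDerivAt_extChartAt_symm_self (I := modelB E) q)
      (extChartAt_to_inv q)).hasFDerivAt_of_model

omit [IsReflexiveSpace E] in
theorem contDiffAt_comp_extChartAt_symm (q : TrivB E G) :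
    ContDiffAt ℝ ∞ (H ∘ (extChartAt (modelB E) q).symm) (extChartAt (modelB E) q q) :=
  ((hH _).comp _ ((contMDiffOn_extChartAt_symm q).contMDiffAt
    ((isOpen_extChartAt_target q).mem_nhds (mem_extChartAt_target q)))).contDiffAt

/-- This is `σ^* θ₁ = -dH` in coordinates, on a whole neighbourhood of the base point, so that it
may be differentiated once more. -/
theorem hamiltonianSection_chart (q : TrivB E G) {y : E × StrongDual ℝ E}
    (hy : y.1 ∈ (extChartAt 𝓘(ℝ, E) q.1).target) :
    ((hamiltonianSection H ((extChartAt (modelB E) q).symm y)).2.comp (mcForm q.1 y.1)).comp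
        (.fst ℝ E (StrongDual ℝ E)) -
      (NormedSpace.inclusionInDoubleDual ℝ E
        (hamiltonianSection H ((extChartAt (modelB E) q).symm y)).1).comp
          (.snd ℝ E (StrongDual ℝ E)) =
      -fderiv ℝ (H ∘ (extChartAt (modelB E) q).symm) y := by
  have hc := (((hH _).mdifferentiableAt (by simp)).hasMFDerivAt.comp y
    (hasMFDerivAt_extChartAt_symm_modelB q hy))
  refine ContinuousLinearMap.ext fun v => ?_
  set q' := (extChartAt (modelB E) q).symm y with hq'
  set A : E →L[ℝ] E := mfderiv 𝓘(ℝ, E) 𝓘(ℝ, E) (extChartAt 𝓘(ℝ, E) q.1).symm y.1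
  have h1 : fderiv ℝ (H ∘ (extChartAt (modelB E) q).symm) y v =
      dOneForm (modelB E) H q' (A v.1, v.2) := by
    rw [hc.hasFDerivAt_of_model.fderiv]
    rfl
  have h2 : pulledDeltaG H q' (tangentRInv q'.1 (A v.1)) = deltaG H q' (A v.1) :=
    congrArg (deltaG H q') (tangentR_tangentRInv q'.1 (A v.1))
  rw [neg_apply, h1, dOneForm_apply hH]
  change -(pulledDeltaG H q' (tangentRInv q'.1 (A v.1))) - v.2 (deltaMu H q') = _
  rw [h2]
  ring

/-- The graph of the Hamiltonian section is isotropic. -/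
theorem d_theta1_hamiltonianSection (q : TrivB E G) (u w : E × StrongDual ℝ E) :
    OneForm.d (modelTT E) theta1 (q, hamiltonianSection H q)
      (u, hamiltonianSectionDeriv H q u) (w, hamiltonianSectionDeriv H q w) = 0 := by
  have hσ := hasFDerivAt_hamiltonianSection_chart hH q
  have hq : (hamiltonianSection H ∘ (extChartAt (modelB E) q).symm) (extChartAt (modelB E) q q) =
    hamiltonianSection H q := congrArg (hamiltonianSection H) (extChartAt_to_inv q)
  have hK := (contDiffAt_comp_extChartAt_symm hH q).of_le two_le_infty
  have hpt : (extChartAt 𝓘(ℝ, E) q.1 q.1, (hamiltonianSection H q).2) =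
      (fun y : E × StrongDual ℝ E => (y.1, ((hamiltonianSection H ∘
        (extChartAt (modelB E) q).symm) y).2)) (extChartAt (modelB E) q q) := by
    dsimp only
    rw [hq]
    rfl
  have h0 := hasFDerivAt_comp_mcForm q.1 (hamiltonianSection H q).2
  rw [hpt] at h0
  have h1 := h0.comp (extChartAt (modelB E) q q) ((hasFDerivAt_fst (𝕜 := ℝ)).prodMk
    (hasFDerivAt_snd.comp (𝕜 := ℝ) _ hσ))
  have h2 := hσ.continuousLinearMap_apply (Z := StrongDual ℝ (StrongDual ℝ E))
    ((NormedSpace.inclusionInDoubleDual ℝ E).comp (.fst ℝ E (StrongDual ℝ E)))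
  have h3 := (h1.clm_comp_const (.fst ℝ E (StrongDual ℝ E))).sub
    (h2.clm_comp_const (.snd ℝ E (StrongDual ℝ E)))
  -- Two derivatives of the same coordinate form are equated: minus the symmetric second derivative
  -- of `H`, and the expression involving `σ` and `mcForm`. Antisymmetrizing the latter gives `dθ₁`
  -- on graph vectors, which is therefore zero.
  have h4 := (hK.hasFDerivAt_fderiv.neg.congr_of_eventuallyEq
    ((eventually_mem_target q).mono fun y hy => hamiltonianSection_chart hH q hy)).unique h3
  have h5 (u w : E × StrongDual ℝ E) := DFunLike.congr_fun (DFunLike.congr_fun h4 u) w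
  have h6 := hK.fderiv_fderiv_swap u w
  have h7 := h5 u w
  have h8 := h5 w u
  rw [neg_apply, neg_apply, h6] at h7
  rw [neg_apply, neg_apply] at h8
  have h9 := h7.symm.trans h8
  rw [d_theta1, ← neg_eq_iff_eq_neg.2 (fderiv_mcForm_sub q.1 u.1 w.1), map_neg,
    map_sub, tangentRInv_eq_mcForm, tangentRInv_eq_mcForm]
  simp at h9 ⊢
  linarith

/-- Subtracting from `v` the graph vector over `v.1`, which is orthogonal to the graph by isotropy,
leaves a vertical vector. Its pairing with graph vectors depends only on their base component `w`,
which is arbitrary, and this pairing separates vertical vectors. -/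
theorem mem_range_of_d_theta1_eq_zero (q : TrivB E G)
    (v : (E × StrongDual ℝ E) × (E × StrongDual ℝ E))
    (h : ∀ w : E × StrongDual ℝ E, OneForm.d (modelTT E) theta1 (q, hamiltonianSection H q)
      v (w, hamiltonianSectionDeriv H q w) = 0) : v.2 = hamiltonianSectionDeriv H q v.1 := by
  have h1 (w : E × StrongDual ℝ E) :
      (v.2.2 - (hamiltonianSectionDeriv H q v.1).2) (tangentRInv q.1 w.1) =
        w.2 (v.2.1 - (hamiltonianSectionDeriv H q v.1).1) := by
    have e1 := (d_theta1 _ _ _).symm.trans (h w)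
    have e2 := (d_theta1 _ _ _).symm.trans (d_theta1_hamiltonianSection hH q v.1 w)
    rw [sub_apply, map_sub]
    dsimp only at e1 e2
    linarith
  have z : tangentRInv (E := E) q.1 (0 : E) = 0 := map_zero _
  refine Prod.ext (eq_of_forall_strongDual_eq fun m => ?_) ?_
  · have := h1 (0, m)
    simp only [z, map_zero, map_sub] at this
    linarith
  · ext ζ
    have := h1 (tangentR q.1 ζ, 0)
    simp only [tangentRInv_tangentR, sub_apply, zero_apply] at this
    linarith

/-- The diffeomorphism of `¹TT^*G` that straightens the graph of the Hamiltonian section. -/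
noncomputable def hamiltonianShear : TrivTT E G ≃ₜ TrivTT E G where
  toFun p := (p.1, p.2 - hamiltonianSection H p.1)
  invFun p := (p.1, p.2 + hamiltonianSection H p.1)
  left_inv p := by simp
  right_inv p := by simp
  continuous_toFun := continuous_fst.prodMk
    (continuous_snd.sub ((contMDiff_hamiltonianSection hH).continuous.comp continuous_fst))
  continuous_invFun := continuous_fst.prodMk
    (continuous_snd.add ((contMDiff_hamiltonianSection hH).continuous.comp continuous_fst))

theorem contMDiff_hamiltonianShear :
    ContMDiff (modelTT E) (modelTT E) ∞ (hamiltonianShear hH) :=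
  contMDiff_fst.prodMk
    (contMDiff_snd.sub ((contMDiff_hamiltonianSection hH).comp contMDiff_fst))

theorem contMDiff_hamiltonianShear_symm :
    ContMDiff (modelTT E) (modelTT E) ∞ (hamiltonianShear hH).symm :=
  contMDiff_fst.prodMk
    (contMDiff_snd.add ((contMDiff_hamiltonianSection hH).comp contMDiff_fst))

theorem hasMFDerivAt_hamiltonianShear (p : TrivTT E G) :
    HasMFDerivAt (modelTT E) (modelTT E) (hamiltonianShear hH) p
      ((ContinuousLinearMap.fst ℝ (E × StrongDual ℝ E) (E × StrongDual ℝ E)).prod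
        (.snd ℝ (E × StrongDual ℝ E) (E × StrongDual ℝ E) -
          (hamiltonianSectionDeriv H p.1).comp
            (.fst ℝ (E × StrongDual ℝ E) (E × StrongDual ℝ E)))) :=
  (hasMFDerivAt_fst p).prodMk ((hasMFDerivAt_snd p).sub
    ((hasMFDerivAt_hamiltonianSection hH p.1).comp p (hasMFDerivAt_fst p)))

/-- A chart around `p` that flattens the graph of the Hamiltonian section. -/
noncomputable def hamiltonianChart (p : TrivTT E G) :
    OpenPartialHomeomorph (TrivTT E G)
      (ModelProd (ModelProd E (StrongDual ℝ E)) (E × StrongDual ℝ E)) :=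
  (hamiltonianShear hH).transOpenPartialHomeomorph (chartAt _ (hamiltonianShear hH p))

theorem hamiltonianChart_mem_maximalAtlas (p : TrivTT E G) :
    hamiltonianChart hH p ∈ IsManifold.maximalAtlas (modelTT E) ∞ (TrivTT E G) := by
  refine OpenPartialHomeomorph.mem_maximalAtlas_of_contMDiffOn _ ?_ ?_
  · exact (contMDiffOn_chart (x := hamiltonianShear hH p)).comp
      (contMDiff_hamiltonianShear hH).contMDiffOn fun _ h => h
  · exact (contMDiff_hamiltonianShear_symm hH).comp_contMDiffOn
      (contMDiffOn_chart_symm (x := hamiltonianShear hH p))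

theorem hasMFDerivAt_hamiltonianChart (p : TrivTT E G) :
    HasMFDerivAt (modelTT E) 𝓘(ℝ, (E × StrongDual ℝ E) × (E × StrongDual ℝ E))
      ((hamiltonianChart hH p).extend (modelTT E)) p
      ((ContinuousLinearMap.fst ℝ (E × StrongDual ℝ E) (E × StrongDual ℝ E)).prod
        (.snd ℝ (E × StrongDual ℝ E) (E × StrongDual ℝ E) -
          (hamiltonianSectionDeriv H p.1).comp
            (.fst ℝ (E × StrongDual ℝ E) (E × StrongDual ℝ E)))) :=
  (hasMFDerivAt_extChartAt_self (I := modelTT E) (hamiltonianShear hH p)).comp_of_point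
    (hasMFDerivAt_hamiltonianShear hH p) rfl

theorem isLagrangianSubmanifold_hamiltonianSet :
    IsLagrangianSubmanifold (modelTT E) (OneForm.d (modelTT E) theta1) (hamiltonianSet H) := by
  intro p hp
  have hp' := (mem_hamiltonianSet_iff hH p).1 hp
  -- The shear sends the graph to the zero section, so the slice is the horizontal factor. Its
  -- preimage under the derivative of the chart is the graph of the derivative of `σ`.
  set F : Submodule ℝ ((E × StrongDual ℝ E) × (E × StrongDual ℝ E)) :=
    LinearMap.ker (ContinuousLinearMap.snd ℝ (E × StrongDual ℝ E) (E × StrongDual ℝ E)).toLinearMap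
  have hF (v : (E × StrongDual ℝ E) × (E × StrongDual ℝ E)) : v ∈ F ↔ v.2 = 0 := Iff.rfl
  have hT (v : (E × StrongDual ℝ E) × (E × StrongDual ℝ E)) :
      v ∈ sliceTangent (modelTT E) p (hamiltonianChart hH p) F ↔
        v.2 = hamiltonianSectionDeriv H p.1 v.1 := by
    rw [sliceTangent, (hasMFDerivAt_hamiltonianChart hH p).mfderiv]
    exact sub_eq_zero
  refine ⟨hamiltonianChart hH p, F, ⟨hamiltonianChart_mem_maximalAtlas hH p, ?_, ?_, ?_⟩, ?_⟩
  · exact mem_chart_source (ModelProd (ModelProd E (StrongDual ℝ E)) (E × StrongDual ℝ E))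
      (hamiltonianShear hH p)
  · exact ContinuousLinearMap.closedComplemented_ker_of_rightInverse _
      (.inr ℝ (E × StrongDual ℝ E) (E × StrongDual ℝ E)) fun _ => rfl
  · intro q _
    rw [mem_hamiltonianSet_iff hH, hF]
    change _ ↔ (q.2 - hamiltonianSection H q.1) - (p.2 - hamiltonianSection H p.1) = 0
    -- Since `p` lies on the graph, its sheared fibre coordinate is zero and the affine slice
    -- through it is linear in the fibre direction.
    rw [hp', sub_self, sub_zero, sub_eq_zero]
  · have hpp : p = (p.1, hamiltonianSection H p.1) := Prod.ext rfl hp'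
    intro v
    refine (hT v).trans ?_
    constructor
    · intro hv w hw
      have hw := (hT w).1 hw
      have := d_theta1_hamiltonianSection hH p.1 (Prod.fst v) (Prod.fst w)
      rw [← hv, ← hw, ← hpp] at this
      exact this
    · intro h
      refine mem_range_of_d_theta1_eq_zero hH p.1 v fun w => ?_
      rw [← hpp]
      exact h _ ((hT _).2 rfl)

end Lagrangian

theorem mainTheorem4 {E : Type*} [NormedAddCommGroup E] [NormedSpace ℝ E] [CompleteSpace E]
    [IsReflexiveSpace E] {G : Type*} [TopologicalSpace G] [ChartedSpace E G] [Group G]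
    [LieGroup 𝓘(ℝ, E) ∞ G]
    (H : TrivB E G → ℝ) (hH : ContMDiff (modelB E) 𝓘(ℝ, ℝ) ∞ H) :
    -- `dθ₁` is an (exact) symplectic form on `¹TT^*G`
    IsSymplecticPotential (modelTT E) (theta1 : OneForm (modelTT E) (M := TrivTT E G)) ∧
    -- the set defined by `-(¹τ)^* dH = θ₁` is a Lagrangian submanifold of `(¹TT^*G, dθ₁)`
    IsLagrangianSubmanifold (modelTT E) (OneForm.d (modelTT E) theta1) (hamiltonianSet H) ∧
    -- it consists of the points `(g, μ, δH/δμ, -T^* R_g (δH/δg))`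
    hamiltonianSet H =
      {p : TrivTT E G | ∃ (g : G) (μ : StrongDual ℝ E),
        p = ((g, μ), (deltaMu H (g, μ), -pulledDeltaG H (g, μ)))} ∧
    -- `H` has exactly one Hamiltonian vector field `X` on `G ⓢ 𝔤^*`; the reconstruction of the set
    -- is the image of `X`, and the components of `X` are those of Hamilton's equations
    (∃ X : ∀ q : TrivB E G, TangentSpace (modelB E) q,
      (∀ Y : ∀ q : TrivB E G, TangentSpace (modelB E) q,
        IsHamiltonianVectorField H Y ↔ Y = X) ∧
      reconstruct '' hamiltonianSet H = Set.range
        (fun q : TrivB E G => (⟨q, X q⟩ : TangentBundle (modelB E) (TrivB E G))) ∧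
      ∀ (g : G) (μ : StrongDual ℝ E),
        X (g, μ) = ((tangentR g (deltaMu H (g, μ)),
          coad G μ (deltaMu H (g, μ)) - pulledDeltaG H (g, μ)) : E × StrongDual ℝ E)) ∧
    -- a curve has its velocity in the reconstructed set iff it solves Hamilton's equations
    (∀ (γ : ℝ → TrivB E G) (t : ℝ), MDifferentiableAt 𝓘(ℝ, ℝ) (modelB E) γ t →
      (velocity γ t ∈ reconstruct '' hamiltonianSet H ↔ SolvesHamiltonAt H γ t)) := by
  refine ⟨isSymplecticPotential_theta1 E G, isLagrangianSubmanifold_hamiltonianSet hH, ?_,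
    ⟨hamiltonianField H, isHamiltonianVectorField_iff hH, reconstruct_image_hamiltonianSet hH,
      fun g μ => rfl⟩, fun γ t hγ => velocity_mem_iff hH hγ⟩
  ext p
  rw [mem_hamiltonianSet_iff hH]
  constructor
  · intro h
    exact ⟨p.1.1, p.1.2, Prod.ext rfl h⟩
  · rintro ⟨g, μ, rfl⟩
    rfl
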